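/- Let $a>b>0$ and let $\mathcal E$ be the ellipse $(x/a)^2+(y/b)^2=1$; put $c^2=a^2-b^2$. Let $\mathcal K$ be a circle with center $C=[x_c,y_c]$ and radius $r$ such that some (nondegenerate) triangle inscribed in $\mathcal E$ has $\mathcal K$ as its incircle, and let $\mathcal T_\circ$ be the Poncelet family of all triangles inscribed in $\mathcal E$ whose incircle is $\mathcal K$. This is a regular one-parameter family: there is a parametrization $u\mapsto T_u$ ($u\in\mathbb R$) of $\mathcal T_\circ$, covering all its triangles up to labelling of the vertices, whose first vertex moves differentiably along $\mathcal E$ with nowhere vanishing velocity. For such a parametrization let $\Gamma_u$ be the radical axis of the incircle and the circumcircle of $T_u$, i.e. the zero set of $F(u,p)=\mathrm{pow}(p,\text{incircle of }T_u)-\mathrm{pow}(p,\text{circumcircle of }T_u)$, and let the envelope of $\Gamma$ be the set of points $p$ such that $F(u,p)=0$ and $\partial F/\partial u\,(u,p)=0$ for some $u$. Let $\mathcal L_3$ be the locus of the circumcenter over $\mathcal T_\circ$. It is an ellipse with foci $F_3=[x_c(1-(b/a)^2),0]$ and $F_3'=[0,y_c(1-(a/b)^2)]$, which are distinct unless $C$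 is the center of $\mathcal E$. Let $\mathcal E_\triangle$ be the locus of the centroids of the equilateral triangles inscribed in $\mathcal E$; it is the ellipse $(x/a_\triangle)^2+(y/b_\triangle)^2=1$ with $a_\triangle=\frac{a c^2}{a^2+3b^2}$, $b_\triangle=\frac{b c^2}{3a^2+b^2}$. **Proposition.** For every such parametrization, the envelope of $\Gamma$ is a nondegenerate conic (ellipse, parabola or hyperbola) whose major axis (the line through the foci for an ellipse or hyperbola, the axis of symmetry for a parabola) is the line $F_3F_3'$, i.e. coincides with the major axis of $\mathcal L_3$. It is an ellipse if $C$ is interior to $\mathcal E_\triangle$ and a hyperbola if $C$ is exterior to $\mathcal E_\triangle$. (If $C$ is the center of $\mathcal E$, then $F_3=F_3'=C$, the "line" $F_3F_3'$ is this single point, and both $\mathcal L_3$ and the envelope are circles centered at $C$.) -/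

import Mathlib

namespace PonceletEnvelope

/-- The Euclidean plane. -/
abbrev Plane : Type := EuclideanSpace ℝ (Fin 2)

/-- The ellipse with equation `(x / a) ^ 2 + (y / b) ^ 2 = 1`. -/
def axisEllipse (a b : ℝ) : Set Plane := {p | (p 0 / a) ^ 2 + (p 1 / b) ^ 2 = 1}

/-- The points interior to the ellipse with equation `(x / a) ^ 2 + (y / b) ^ 2 = 1`. -/
def axisEllipseInterior (a b : ℝ) : Set Plane := {p | (p 0 / a) ^ 2 + (p 1 / b) ^ 2 < 1}

/-- The points exterior to the ellipse with equation `(x / a) ^ 2 + (y / b) ^ 2 = 1`. -/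
def axisEllipseExterior (a b : ℝ) : Set Plane := {p | 1 < (p 0 / a) ^ 2 + (p 1 / b) ^ 2}

/-- The nondegenerate triangles inscribed in the ellipse with semiaxes `a`, `b`. -/
def inscribedTriangles (a b : ℝ) : Set (Affine.Triangle ℝ Plane) :=
  {t | ∀ i, t.points i ∈ axisEllipse a b}

/-- The Poncelet family of triangles inscribed in the ellipse with semiaxes `a`, `b` and
circumscribing the circle with center `C` and radius `r` (their common incircle). -/
def ponceletFamily (a b : ℝ) (C : Plane) (r : ℝ) : Set (Affine.Triangle ℝ Plane) :=
  {t | t ∈ inscribedTriangles a b ∧ t.insphere = ⟨C, r⟩}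

/-- A regular parametrization of the Poncelet family: the first vertex moves differentiably with
nonzero velocity (it determines the two other vertices up to their order), and every triangle of
the family is met, up to the labelling of its vertices. -/
structure IsRegularParametrization (a b : ℝ) (C : Plane) (r : ℝ)
    (T : ℝ → Affine.Triangle ℝ Plane) : Prop where
  mem : ∀ u, T u ∈ ponceletFamily a b C r
  regular : ∀ u, ∃ v : Plane, v ≠ 0 ∧ HasDerivAt (fun s => (T s).points 0) v u
  covers : ∀ t ∈ ponceletFamily a b C r, ∃ u, Set.range t.points = Set.range (T u).points

/-- The power of `p` with respect to the incircle of `t` minus its power with respect to the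
circumcircle of `t`; an affine function of `p`, whose zero set is the radical axis of the two
circles. -/
noncomputable def radicalFunction (t : Affine.Triangle ℝ Plane) (p : Plane) : ℝ :=
  t.insphere.power p - t.circumsphere.power p

/-- The envelope of the one-parameter family of curves `F u p = 0`: the points which, for some
parameter `u`, satisfy both `F u p = 0` and `∂F/∂u (u, p) = 0`. -/
def envelope (F : ℝ → Plane → ℝ) : Set Plane :=
  {p | ∃ u, F u p = 0 ∧ HasDerivAt (fun s => F s p) 0 u}

/-- The locus of the circumcenter over the Poncelet family. -/
def circumcenterLocus (a b : ℝ) (C : Plane) (r : ℝ) : Set Plane :=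
  {p | ∃ t ∈ ponceletFamily a b C r, t.circumcenter = p}

/-- The locus of the centroids of the equilateral triangles inscribed in the ellipse with
semiaxes `a`, `b`. -/
def equilateralCentroidLocus (a b : ℝ) : Set Plane :=
  {p | ∃ t ∈ inscribedTriangles a b, t.Equilateral ∧ t.centroid = p}

/-- `S` is a nondegenerate ellipse with foci `G`, `G'` (a circle of positive radius
if `G = G'`). -/
def IsEllipseWithFoci (S : Set Plane) (G G' : Plane) : Prop :=
  ∃ s : ℝ, dist G G' < 2 * s ∧ S = {p | dist p G + dist p G' = 2 * s}

/-- `S` is a nondegenerate hyperbola with foci `G`, `G'`. -/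
def IsHyperbolaWithFoci (S : Set Plane) (G G' : Plane) : Prop :=
  ∃ s : ℝ, 0 < s ∧ 2 * s < dist G G' ∧ S = {p | |dist p G - dist p G'| = 2 * s}

/-- `S` is an ellipse whose foci span `M`. If `M` is a line, the foci are distinct, the ellipse
is not a circle, and `M` is its major axis; if `M` is a single point, `S` is a circle centered
at that point. -/
def IsEllipseAlong (S : Set Plane) (M : AffineSubspace ℝ Plane) : Prop :=
  ∃ G G' : Plane, IsEllipseWithFoci S G G' ∧ line[ℝ, G, G'] = M

/-- `S` is a hyperbola whose foci span `M`, i.e. whose major (transverse) axis is `M`. -/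
def IsHyperbolaAlong (S : Set Plane) (M : AffineSubspace ℝ Plane) : Prop :=
  ∃ G G' : Plane, IsHyperbolaWithFoci S G G' ∧ line[ℝ, G, G'] = M

/-- `S` is a parabola whose axis of symmetry is `M`. Here `G` is the focus, `n` a unit vector
along the axis, `{p | ⟪n, p - G⟫ + h = 0}` the directrix, so that `|⟪n, p - G⟫ + h|` is the
distance from `p` to the directrix. -/
def IsParabolaAlong (S : Set Plane) (M : AffineSubspace ℝ Plane) : Prop :=
  ∃ (G n : Plane) (h : ℝ), ‖n‖ = 1 ∧ 0 < h ∧ S = {p | dist p G = |inner ℝ n (p - G) + h|} ∧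
    AffineSubspace.mk' G (Submodule.span ℝ {n}) = M

/-- `S` is a nondegenerate conic with major axis `M`. -/
def IsConicAlong (S : Set Plane) (M : AffineSubspace ℝ Plane) : Prop :=
  IsEllipseAlong S M ∨ IsParabolaAlong S M ∨ IsHyperbolaAlong S M

/-- The point `[x_c (1 - (b / a) ^ 2), 0]`. -/
noncomputable def focusX (a b : ℝ) (C : Plane) : Plane := !₂[C 0 * (1 - (b / a) ^ 2), 0]

/-- The point `[0, y_c (1 - (a / b) ^ 2)]`. -/
noncomputable def focusY (a b : ℝ) (C : Plane) : Plane := !₂[0, C 1 * (1 - (a / b) ^ 2)]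

end PonceletEnvelope

/-! Rescale the axes so that the outer ellipse becomes the unit circle of ℂ. The incircle becomes an
ellipse with center `h` and foci f, g = h ± i√(r²(1/b² − 1/a²)), both in the open disc. With β = fg,
the vertices of a triangle of the family are the three solutions of B(x) = l, where |l| = 1 and B is
the Blaschke product x(x − f)(x − g)/((1 − f̄x)(1 − ḡx)). Tangency forces one relation between a, b,
r, h that does not involve the vertices; conversely, under this relation every unimodular l yields a
triangle of the family. This is Poncelet's porism (`HasIncircle.isPoristic_and_sum`,
`injective_and_hasIncircle`, `mem_family_iff`). So l is a coordinate on the family, and the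
symmetric functions of the vertices are 2h + lβ̄, β + 2lh̄ and l.

Since these are affine in l and l̄, so are the circumcenter and the power of the origin with respect
to the circumcircle (`circumsphere_of_mem_family`). Hence the circumcenter runs over an affine image
of the unit circle, and the radical function is A + B₁ Re l + B₂ Im l with A, B₁, B₂ affine in the
point (`radicalFunction_eq`). As l moves with nonzero speed, the envelope is A² = B₁² + B₂²
(`mem_envelope_iff`).

B₁ and B₂ vanish together at a point c of F₃F₃', and for y = P − c the equation becomes K‖y‖² =
q(⟨v, y⟩) with q quadratic and v spanning the direction of F₃F₃'. Such a conic is symmetric about c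
+ ℝv, and its type is the sign of K − N‖v‖², where N is the leading coefficient of q. Eliminating r
with the porism relation turns this sign into the position of C relative to the ellipse of
equilateral centroids. -/

namespace PonceletEnvelope

/-! ### Central conics: from the quadratic equation to the foci. -/

section Conics

variable {V : Type*} [NormedAddCommGroup V] [InnerProductSpace ℝ V]

/-- The focal radii of a central conic are affine along the axis (the classical a ± ex): the
equation divided by s² completes ‖y ∓ f‖² to a square. Ellipse and hyperbola differ only in how the
absolute values open. -/
theorem norm_sub_sq_of_quadratic {f y : V} {s : ℝ} (hs : s ≠ 0)
    (h : s ^ 2 * ‖y‖ ^ 2 - inner ℝ f y ^ 2 = s ^ 2 * (s ^ 2 - ‖f‖ ^ 2)) :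
    ‖y - f‖ = |s - inner ℝ f y / s| ∧ ‖y + f‖ = |s + inner ℝ f y / s| := by
  have key : ‖y‖ ^ 2 + ‖f‖ ^ 2 = s ^ 2 + (inner ℝ f y / s) ^ 2 := by
    field_simp
    linarith
  have hc : inner ℝ f y = s * (inner ℝ f y / s) := by field_simp
  constructor
  · rw [← abs_of_nonneg (norm_nonneg (y - f)), ← sq_eq_sq_iff_abs_eq_abs, norm_sub_sq_real,
      real_inner_comm]
    nlinarith
  · rw [← abs_of_nonneg (norm_nonneg (y + f)), ← sq_eq_sq_iff_abs_eq_abs, norm_add_sq_real,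
      real_inner_comm]
    nlinarith

/-- Let S and D be the sum and the difference of the focal radii. Both S² + D² and S²D² are
polynomials in y, and the asserted equation is (S² − 4s²)(D² − 4s²) = 0 expanded. -/
theorem quadratic_of_norm_sub_sq {f y : V} {s : ℝ}
    (h : (‖y - f‖ + ‖y + f‖) ^ 2 = 4 * s ^ 2 ∨ (‖y - f‖ - ‖y + f‖) ^ 2 = 4 * s ^ 2) :
    s ^ 2 * ‖y‖ ^ 2 - inner ℝ f y ^ 2 = s ^ 2 * (s ^ 2 - ‖f‖ ^ 2) := by
  have h1 : ‖y - f‖ ^ 2 = ‖y‖ ^ 2 - 2 * inner ℝ f y + ‖f‖ ^ 2 := by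
    rw [norm_sub_sq_real, real_inner_comm]
  have h2 : ‖y + f‖ ^ 2 = ‖y‖ ^ 2 + 2 * inner ℝ f y + ‖f‖ ^ 2 := by
    rw [norm_add_sq_real, real_inner_comm]
  have h3 : ‖y + f‖ ^ 2 - ‖y - f‖ ^ 2 = 4 * inner ℝ f y := by linarith
  have h4 : ‖y + f‖ ^ 2 + ‖y - f‖ ^ 2 = 2 * ‖y‖ ^ 2 + 2 * ‖f‖ ^ 2 := by linarith
  have hP : (‖y - f‖ + ‖y + f‖) ^ 2 * (‖y - f‖ - ‖y + f‖) ^ 2 = 16 * inner ℝ f y ^ 2 := by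
    linear_combination (‖y + f‖ ^ 2 - ‖y - f‖ ^ 2 + 4 * inner ℝ f y) * h3
  have hS : (‖y - f‖ + ‖y + f‖) ^ 2 + (‖y - f‖ - ‖y + f‖) ^ 2 =
      4 * ‖y‖ ^ 2 + 4 * ‖f‖ ^ 2 := by linear_combination 2 * h4
  rcases h with h | h
  · rw [h] at hP hS
    linear_combination (-1 / 4) * s ^ 2 * hS + (1 / 16) * hP
  · rw [h] at hP hS
    linear_combination (-1 / 4) * s ^ 2 * hS + (1 / 16) * hP

theorem norm_sub_add_norm_add_eq_iff {f y : V} {s : ℝ} (hs : ‖f‖ < s) :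
    ‖y - f‖ + ‖y + f‖ = 2 * s ↔
      s ^ 2 * ‖y‖ ^ 2 - inner ℝ f y ^ 2 = s ^ 2 * (s ^ 2 - ‖f‖ ^ 2) := by
  have hs0 : 0 < s := (norm_nonneg f).trans_lt hs
  refine ⟨fun h => quadratic_of_norm_sub_sq (Or.inl (by rw [h]; ring)), fun h => ?_⟩
  obtain ⟨h1, h2⟩ := norm_sub_sq_of_quadratic hs0.ne' h
  have hf : 0 < s ^ 2 - ‖f‖ ^ 2 := by nlinarith [norm_nonneg f]
  have hcs : inner ℝ f y ^ 2 ≤ ‖f‖ ^ 2 * ‖y‖ ^ 2 := by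
    rw [← mul_pow, ← sq_abs]
    exact pow_le_pow_left₀ (abs_nonneg _) (abs_real_inner_le_norm f y) 2
  -- Eliminating ‖y‖ between the equation and Cauchy–Schwarz bounds the inner product by s‖f‖, which
  -- makes both focal radii open with a plus sign.
  have hle : inner ℝ f y ^ 2 ≤ s ^ 4 := by
    have h3 : (s ^ 2 - ‖f‖ ^ 2) * inner ℝ f y ^ 2 ≤ (s ^ 2 - ‖f‖ ^ 2) * (s ^ 2 * ‖f‖ ^ 2) := by
      nlinarith
    have h4 := le_of_mul_le_mul_left h3 hf
    nlinarith [sq_nonneg s]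
  have habs : |inner ℝ f y| ≤ s ^ 2 := abs_le_of_sq_le_sq (by nlinarith) (by positivity)
  have hdiv : |inner ℝ f y / s| ≤ s := by
    rw [abs_div, abs_of_pos hs0, div_le_iff₀ hs0]
    nlinarith
  obtain ⟨h5, h6⟩ := abs_le.1 hdiv
  rw [h1, h2, abs_of_nonneg (by linarith), abs_of_nonneg (by linarith)]
  ring

theorem abs_norm_sub_sub_norm_add_eq_iff {f y : V} {s : ℝ} (hs0 : 0 < s) (hs : s < ‖f‖) :
    |‖y - f‖ - ‖y + f‖| = 2 * s ↔
      s ^ 2 * ‖y‖ ^ 2 - inner ℝ f y ^ 2 = s ^ 2 * (s ^ 2 - ‖f‖ ^ 2) := by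
  refine ⟨fun h => quadratic_of_norm_sub_sq (Or.inr (by rw [← sq_abs, h]; ring)), fun h => ?_⟩
  obtain ⟨h1, h2⟩ := norm_sub_sq_of_quadratic hs0.ne' h
  have hf : 0 < ‖f‖ ^ 2 - s ^ 2 := by nlinarith
  have hcs : inner ℝ f y ^ 2 ≤ ‖f‖ ^ 2 * ‖y‖ ^ 2 := by
    rw [← mul_pow, ← sq_abs]
    exact pow_le_pow_left₀ (abs_nonneg _) (abs_real_inner_le_norm f y) 2
  -- The same elimination, with the inequality reversed because now s < ‖f‖; exactly one focal
  -- radius changes sign.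
  have hle : s ^ 4 ≤ inner ℝ f y ^ 2 := by
    have h3 : (‖f‖ ^ 2 - s ^ 2) * (s ^ 2 * ‖f‖ ^ 2) ≤ (‖f‖ ^ 2 - s ^ 2) * inner ℝ f y ^ 2 := by
      nlinarith
    have h4 := le_of_mul_le_mul_left h3 hf
    nlinarith [sq_nonneg s]
  have habs : s ^ 2 ≤ |inner ℝ f y| := by
    refine (pow_le_pow_iff_left₀ (by positivity) (abs_nonneg _) two_ne_zero).1 ?_
    rw [sq_abs]
    linarith
  have hdiv : s ≤ |inner ℝ f y / s| := by
    rw [abs_div, abs_of_pos hs0, le_div_iff₀ hs0]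
    nlinarith
  rw [h1, h2]
  rcases le_abs.1 hdiv with h5 | h5
  · rw [abs_of_nonpos (show s - inner ℝ f y / s ≤ 0 by linarith),
      abs_of_nonneg (show 0 ≤ s + inner ℝ f y / s by linarith)]
    rw [show -(s - inner ℝ f y / s) - (s + inner ℝ f y / s) = -(2 * s) by ring, abs_neg,
      abs_of_pos (by linarith)]
  · rw [abs_of_nonneg (show 0 ≤ s - inner ℝ f y / s by linarith),
      abs_of_nonpos (show s + inner ℝ f y / s ≤ 0 by linarith)]
    rw [show (s - inner ℝ f y / s) - -(s + inner ℝ f y / s) = 2 * s by ring,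
      abs_of_pos (by linarith)]

end Conics

theorem isEllipseWithFoci_of_quadratic {S : Set Plane} {c f : Plane} {s : ℝ} (hs : ‖f‖ < s)
    (hS : ∀ p, p ∈ S ↔
      s ^ 2 * ‖p - c‖ ^ 2 - inner ℝ f (p - c) ^ 2 = s ^ 2 * (s ^ 2 - ‖f‖ ^ 2)) :
    IsEllipseWithFoci S (c + f) (c - f) := by
  refine ⟨s, ?_, ?_⟩
  · rw [dist_eq_norm, show c + f - (c - f) = (2 : ℝ) • f by module, norm_smul]
    norm_num
    exact hs
  · ext p
    rw [hS, Set.mem_ofPred_eq, ← norm_sub_add_norm_add_eq_iff hs, dist_eq_norm, dist_eq_norm,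
      sub_add_eq_sub_sub, ← sub_add]

theorem isHyperbolaWithFoci_of_quadratic {S : Set Plane} {c f : Plane} {s : ℝ} (hs0 : 0 < s)
    (hs : s < ‖f‖) (hS : ∀ p, p ∈ S ↔
      s ^ 2 * ‖p - c‖ ^ 2 - inner ℝ f (p - c) ^ 2 = s ^ 2 * (s ^ 2 - ‖f‖ ^ 2)) :
    IsHyperbolaWithFoci S (c + f) (c - f) := by
  refine ⟨s, hs0, ?_, ?_⟩
  · rw [dist_eq_norm, show c + f - (c - f) = (2 : ℝ) • f by module, norm_smul]
    norm_num
    exact hs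
  · ext p
    rw [hS, Set.mem_ofPred_eq, ← abs_norm_sub_sub_norm_add_eq_iff hs0 hs, dist_eq_norm,
      dist_eq_norm, sub_add_eq_sub_sub, ← sub_add]

theorem line_add_smul_add_smul (c v : Plane) {s t : ℝ} (hst : s ≠ t) :
    line[ℝ, c + s • v, c + t • v] = AffineSubspace.mk' c (Submodule.span ℝ {v}) := by
  have hst' : t - s ≠ 0 := sub_ne_zero.2 hst.symm
  apply AffineSubspace.eq_of_direction_eq_of_nonempty_of_le
  · rw [direction_affineSpan, vectorSpan_pair_rev, AffineSubspace.direction_mk', vsub_eq_sub,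
      show c + t • v - (c + s • v) = (t - s) • v by module]
    exact Submodule.span_singleton_smul_eq (IsUnit.mk0 _ hst') v
  · exact ⟨_, left_mem_affineSpan_pair ℝ _ _⟩
  · apply affineSpan_pair_le_of_mem_of_mem <;>
    · rw [AffineSubspace.mem_mk', vsub_eq_sub, add_sub_cancel_left]
      exact Submodule.smul_mem _ _ (Submodule.mem_span_singleton_self v)

theorem mk'_add_smul_span_singleton (c v : Plane) (t : ℝ) :
    AffineSubspace.mk' (c + t • v) (Submodule.span ℝ {v}) =
      AffineSubspace.mk' c (Submodule.span ℝ {v}) := by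
  ext p
  rw [AffineSubspace.mem_mk', AffineSubspace.mem_mk', vsub_eq_sub, vsub_eq_sub,
    ← sub_sub, Submodule.sub_mem_iff_left]
  exact Submodule.smul_mem _ _ (Submodule.mem_span_singleton_self v)

/-- The line through the foci of a central conic. -/
theorem line_foci (c v : Plane) {γ φ : ℝ} (hφ : φ ≠ 0) :
    line[ℝ, c + γ • v + φ • v, c + γ • v - φ • v] =
      AffineSubspace.mk' c (Submodule.span ℝ {v}) := by
  rw [← line_add_smul_add_smul c v (s := γ + φ) (t := γ - φ) (fun h => hφ (by linarith))]
  rw [add_smul, sub_smul, ← add_assoc, ← add_sub_assoc]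

/-! ### Conics of the form K‖y‖² = quadratic in ⟨v, y⟩. -/

section FocalEquation

variable {S : Set Plane} {c v : Plane} {K A M N : ℝ}

/-- Complete the square along v. The quadratic part has eigenvalue K across v and J along it, so J ≠
0 gives a center. The relation between φ and s says that the squared eccentricity is N‖v‖²/K. Since
φ > 0 even for v = 0, the circle needs no separate treatment. -/
theorem central_form_of_focal_form (hK : 0 < K) (hA : 0 < A) (hN : 0 < N) (hMN : N < M ^ 2)
    (hJ : K - N * ‖v‖ ^ 2 ≠ 0)
    (hS : ∀ p, p ∈ S ↔ K * ‖p - c‖ ^ 2 =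
      A ^ 2 - 2 * M * A * inner ℝ v (p - c) + N * inner ℝ v (p - c) ^ 2) :
    ∃ γ s φ : ℝ, 0 < s ∧ 0 < φ ∧ K * ‖φ • v‖ ^ 2 = s ^ 2 * (N * ‖v‖ ^ 2) ∧ ∀ p, p ∈ S ↔
      s ^ 2 * ‖p - (c + γ • v)‖ ^ 2 - inner ℝ (φ • v) (p - (c + γ • v)) ^ 2 =
        s ^ 2 * (s ^ 2 - ‖φ • v‖ ^ 2) := by
  set J := K - N * ‖v‖ ^ 2 with hJdef
  have hpos : 0 < K + (M ^ 2 - N) * ‖v‖ ^ 2 := by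
    have : 0 < M ^ 2 - N := by linarith
    positivity
  have hs : 0 < A * √(K + (M ^ 2 - N) * ‖v‖ ^ 2) / |J| := by positivity
  -- After the shift by γv the constant term is A² − MAγ‖v‖², which has to be s²J; substituting γJ =
  -- −MA gives this s. Its radicand is positive because N < M².
  obtain ⟨s, hsdef⟩ : ∃ s, s = A * √(K + (M ^ 2 - N) * ‖v‖ ^ 2) / |J| := ⟨_, rfl⟩
  rw [← hsdef] at hs
  have hs2 : s ^ 2 * J ^ 2 = A ^ 2 * (K + (M ^ 2 - N) * ‖v‖ ^ 2) := by
    rw [hsdef, div_pow, mul_pow, Real.sq_sqrt hpos.le, sq_abs]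
    field_simp
  have hφ : 0 < s * √(N / K) := by positivity
  obtain ⟨φ, hφdef⟩ : ∃ φ, φ = s * √(N / K) := ⟨_, rfl⟩
  rw [← hφdef] at hφ
  have hφ2 : K * φ ^ 2 = s ^ 2 * N := by
    rw [hφdef, mul_pow, Real.sq_sqrt (by positivity)]
    field_simp
  have hf : K * ‖φ • v‖ ^ 2 = s ^ 2 * (N * ‖v‖ ^ 2) := by
    rw [norm_smul, mul_pow, Real.norm_eq_abs, sq_abs]
    linear_combination ‖v‖ ^ 2 * hφ2
  refine ⟨-M * A / J, s, φ, hs, hφ, hf, fun p => ?_⟩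
  rw [hS]
  obtain ⟨y, hy⟩ : ∃ y, y = p - c := ⟨_, rfl⟩
  obtain ⟨γ, hγ⟩ : ∃ γ, γ = -M * A / J := ⟨_, rfl⟩
  have hγJ : γ * J = -M * A := by rw [hγ]; field_simp
  rw [← hγ, ← sub_sub, ← hy, norm_sub_sq_real, inner_sub_right, inner_smul_left, inner_smul_right,
    inner_smul_left, inner_smul_right, real_inner_self_eq_norm_sq, real_inner_comm v y]
  simp only [norm_smul, mul_pow, Real.norm_eq_abs, sq_abs, conj_trivial]
  obtain ⟨w, hw⟩ : ∃ w, w = inner ℝ v y := ⟨_, rfl⟩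
  obtain ⟨n, hn⟩ : ∃ n, n = ‖y‖ ^ 2 := ⟨_, rfl⟩
  obtain ⟨X, hX⟩ : ∃ X, X = ‖v‖ ^ 2 := ⟨_, rfl⟩
  rw [← hw, ← hn, ← hX]
  rw [← hX] at hs2 hJdef
  have hsJ : s ^ 2 * J = A ^ 2 - M * A * γ * X := by
    apply mul_right_cancel₀ hJ
    linear_combination hs2 - A ^ 2 * hJdef + M * A * X * hγJ
  constructor
  · intro h
    apply mul_left_cancel₀ hK.ne'
    linear_combination s ^ 2 * h - (w - γ * X) ^ 2 * hφ2 + s ^ 2 * X * hφ2 +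
      s ^ 2 * (-2 * γ * w + γ ^ 2 * X) * hJdef.symm - s ^ 2 * hsJ - s ^ 4 * hJdef.symm +
      s ^ 2 * (γ * X - 2 * w) * hγJ
  · intro h
    apply mul_left_cancel₀ (pow_ne_zero 2 hs.ne')
    linear_combination K * h + (w - γ * X) ^ 2 * hφ2 - s ^ 2 * X * hφ2 -
      s ^ 2 * (-2 * γ * w + γ ^ 2 * X) * hJdef.symm + s ^ 2 * hsJ + s ^ 4 * hJdef.symm -
      s ^ 2 * (γ * X - 2 * w) * hγJ

theorem isEllipseAlong_of_focal_form (hK : 0 < K) (hA : 0 < A) (hN : 0 < N) (hMN : N < M ^ 2)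
    (hJ : N * ‖v‖ ^ 2 < K)
    (hS : ∀ p, p ∈ S ↔ K * ‖p - c‖ ^ 2 =
      A ^ 2 - 2 * M * A * inner ℝ v (p - c) + N * inner ℝ v (p - c) ^ 2) :
    IsEllipseAlong S (AffineSubspace.mk' c (Submodule.span ℝ {v})) := by
  obtain ⟨γ, s, φ, hs, hφ, hf, h⟩ :=
    central_form_of_focal_form hK hA hN hMN (sub_ne_zero.2 hJ.ne') hS
  refine ⟨_, _, isEllipseWithFoci_of_quadratic ?_ h, line_foci c v hφ.ne'⟩
  refine lt_of_pow_lt_pow_left₀ 2 hs.le (lt_of_mul_lt_mul_left ?_ hK.le)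
  rw [hf, mul_comm K]
  exact mul_lt_mul_of_pos_left hJ (by positivity)

theorem isHyperbolaAlong_of_focal_form (hK : 0 < K) (hA : 0 < A) (hN : 0 < N) (hMN : N < M ^ 2)
    (hJ : K < N * ‖v‖ ^ 2)
    (hS : ∀ p, p ∈ S ↔ K * ‖p - c‖ ^ 2 =
      A ^ 2 - 2 * M * A * inner ℝ v (p - c) + N * inner ℝ v (p - c) ^ 2) :
    IsHyperbolaAlong S (AffineSubspace.mk' c (Submodule.span ℝ {v})) := by
  obtain ⟨γ, s, φ, hs, hφ, hf, h⟩ :=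
    central_form_of_focal_form hK hA hN hMN (sub_ne_zero.2 hJ.ne) hS
  refine ⟨_, _, isHyperbolaWithFoci_of_quadratic hs ?_ h, line_foci c v hφ.ne'⟩
  refine lt_of_pow_lt_pow_left₀ 2 (norm_nonneg _) (lt_of_mul_lt_mul_left ?_ hK.le)
  rw [hf, mul_comm K]
  exact mul_lt_mul_of_pos_left hJ (by positivity)

theorem isParabolaAlong_of_focal_form (hK : 0 < K) (hA : 0 < A) (hM : 0 < M)
    (hJ : K = N * ‖v‖ ^ 2)
    (hS : ∀ p, p ∈ S ↔ K * ‖p - c‖ ^ 2 =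
      A ^ 2 - 2 * M * A * inner ℝ v (p - c) + N * inner ℝ v (p - c) ^ 2) :
    IsParabolaAlong S (AffineSubspace.mk' c (Submodule.span ℝ {v})) := by
  have hv : ‖v‖ ≠ 0 := by
    intro h
    rw [h] at hJ
    norm_num at hJ
    exact hK.ne' hJ
  have hv0 : 0 < ‖v‖ := (norm_nonneg v).lt_of_ne' hv
  -- With J = 0 the square cannot be completed. The terms linear in ⟨v, y⟩ fix the directrix offset
  -- MA‖v‖/K, and the constant terms fix the position g of the focus.
  obtain ⟨g, hg⟩ : ∃ g, g = (N - M ^ 2) * A / (2 * M * K) := ⟨_, rfl⟩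
  have hg' : 2 * M * K * g = (N - M ^ 2) * A := by rw [hg]; field_simp
  refine ⟨c + g • v, (-‖v‖⁻¹) • v, M * A * ‖v‖ / K, ?_, by positivity, ?_, ?_⟩
  · rw [norm_smul, norm_neg, norm_inv, norm_norm, inv_mul_cancel₀ hv]
  · ext p
    rw [hS, Set.mem_ofPred_eq, dist_eq_norm, ← abs_of_nonneg (norm_nonneg (p - (c + g • v))),
      ← sq_eq_sq_iff_abs_eq_abs]
    obtain ⟨y, hy⟩ : ∃ y, y = p - c := ⟨_, rfl⟩
    rw [← sub_sub, ← hy, norm_sub_sq_real, inner_sub_right, inner_smul_left, inner_smul_right,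
      inner_smul_right, inner_smul_left, real_inner_self_eq_norm_sq, real_inner_comm v y]
    simp only [norm_smul, mul_pow, Real.norm_eq_abs, sq_abs, conj_trivial]
    obtain ⟨w, hw⟩ : ∃ w, w = inner ℝ v y := ⟨_, rfl⟩
    obtain ⟨n, hn⟩ : ∃ n, n = ‖y‖ ^ 2 := ⟨_, rfl⟩
    obtain ⟨x, hx⟩ : ∃ x, x = ‖v‖ := ⟨_, rfl⟩
    rw [← hw, ← hn, ← hx]
    rw [← hx] at hv0 hJ
    have hN : N = K / x ^ 2 := by rw [hJ]; field_simp
    have key : K * (n - 2 * (g * w) + g ^ 2 * x ^ 2 -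
        (-x⁻¹ * w - g * (-x⁻¹ * x ^ 2) + M * A * x / K) ^ 2) =
        K * n - (A ^ 2 - 2 * M * A * w + N * w ^ 2) := by
      have hg2 : g = (K / x ^ 2 - M ^ 2) * A / (2 * M * K) := by rw [hg, hN]
      rw [hN, hg2]
      field_simp
      ring
    constructor
    · intro h
      have : K * (n - 2 * (g * w) + g ^ 2 * x ^ 2 -
        (-x⁻¹ * w - g * (-x⁻¹ * x ^ 2) + M * A * x / K) ^ 2) = 0 := by rw [key]; linarith
      have h2 := (mul_eq_zero.1 this).resolve_left hK.ne'
      linear_combination h2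
    · intro h
      have : K * (n - 2 * (g * w) + g ^ 2 * x ^ 2 -
        (-x⁻¹ * w - g * (-x⁻¹ * x ^ 2) + M * A * x / K) ^ 2) = 0 := by
        rw [mul_eq_zero]; right; linear_combination h
      linarith
  · rw [Submodule.span_singleton_smul_eq (IsUnit.mk0 _ (neg_ne_zero.2 (inv_ne_zero hv)))]
    exact mk'_add_smul_span_singleton c v g

end FocalEquation
-- Incircles in barycentric coordinates, and the chart to the unit circle.
section Triangles

/-- Twice the signed area of the triangle with vertices `p`, `q`, `s`. -/
def cross (p q s : Plane) : ℝ :=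
  (q 0 - p 0) * (s 1 - p 1) - (q 1 - p 1) * (s 0 - p 0)

theorem plane_norm_sq (p : Plane) : ‖p‖ ^ 2 = p 0 ^ 2 + p 1 ^ 2 := by
  rw [EuclideanSpace.norm_sq_eq]
  simp [Fin.sum_univ_two]

theorem plane_inner (p q : Plane) : inner ℝ p q = p 0 * q 0 + p 1 * q 1 := by
  rw [PiLp.inner_apply, Fin.sum_univ_two]
  simp [mul_comm]

theorem plane_dist_sq (p q : Plane) : dist p q ^ 2 = (p 0 - q 0) ^ 2 + (p 1 - q 1) ^ 2 := by
  rw [dist_eq_norm, plane_norm_sq]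
  simp

theorem plane_ext {p q : Plane} (h0 : p 0 = q 0) (h1 : p 1 = q 1) : p = q := by
  ext i
  fin_cases i <;> assumption

theorem affineIndependent_of_cross_ne_zero {p : Fin 3 → Plane}
    (h : cross (p 0) (p 1) (p 2) ≠ 0) : AffineIndependent ℝ p := by
  rw [affineIndependent_iff_not_collinear]
  intro hc
  obtain ⟨v, hv⟩ := (collinear_iff_of_mem (Set.mem_range_self (0 : Fin 3))).1 hc
  obtain ⟨s, hs⟩ := hv _ (Set.mem_range_self (1 : Fin 3))
  obtain ⟨t, ht⟩ := hv _ (Set.mem_range_self (2 : Fin 3))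
  apply h
  rw [hs, ht]
  simp [cross]
  ring

theorem cross_rotate (p q s : Plane) : cross q s p = cross p q s := by
  unfold cross
  ring

/-- Base times height is twice the area; squaring avoids the orientation. -/
theorem height_sq_mul_dist_sq_eq_cross_sq (t : Affine.Triangle ℝ Plane) {i j k : Fin 3}
    (hij : i ≠ j) (hik : i ≠ k) :
    t.height i ^ 2 * dist (t.points j) (t.points k) ^ 2 =
      cross (t.points i) (t.points j) (t.points k) ^ 2 := by
  have hj := t.inner_vsub_vsub_altitudeFoot_eq_height_sq hij
  have hk := t.inner_vsub_vsub_altitudeFoot_eq_height_sq hik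
  have hn : t.height i ^ 2 = dist (t.points i) (t.altitudeFoot i) ^ 2 := rfl
  have hpos := t.height_pos i
  rw [plane_dist_sq] at hn
  rw [vsub_eq_sub, vsub_eq_sub, plane_inner] at hj hk
  rw [plane_dist_sq]
  simp only [PiLp.sub_apply] at hj hk
  unfold cross
  generalize t.points i = P at *
  generalize t.points j = Q at *
  generalize t.points k = S at *
  generalize t.altitudeFoot i = F at *
  generalize t.height i = H at *
  have h0 : (P 0 - F 0) * (Q 0 - S 0) + (P 1 - F 1) * (Q 1 - S 1) = 0 := by linarith
  have h1 : H ^ 2 * ((Q 0 - P 0) * (S 1 - P 1) - (Q 1 - P 1) * (S 0 - P 0)) =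
      H ^ 2 * ((P 0 - F 0) * (Q 1 - S 1) - (P 1 - F 1) * (Q 0 - S 0)) := by
    linear_combination ((Q 0 - P 0) * (S 1 - P 1) - (Q 1 - P 1) * (S 0 - P 0)) * hn +
      ((P 0 - F 0) * (Q 1 - S 1) - (P 1 - F 1) * (Q 0 - S 0)) * hj +
      ((P 0 - Q 0) * (P 1 - F 1) - (P 1 - Q 1) * (P 0 - F 0)) * h0
  have h2 := mul_left_cancel₀ (pow_ne_zero 2 hpos.ne') h1
  rw [h2, hn]
  linear_combination ((P 0 - F 0) * (Q 0 - S 0) + (P 1 - F 1) * (Q 1 - S 1)) * h0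

/-- A point with barycentric weights `w` has signed distance `w i * height i` from side i, and the
incenter is the only point where these all agree. Multiplying by the side and squaring makes the
condition polynomial; positivity of the weights restores the lost signs and excludes the excircles.
-/
theorem insphere_eq_iff (t : Affine.Triangle ℝ Plane) (C : Plane) (r : ℝ) :
    t.insphere = ⟨C, r⟩ ↔ 0 < r ∧ ∃ w : Fin 3 → ℝ, (∀ i, 0 < w i) ∧ ∑ i, w i = 1 ∧
      ∑ i, w i • t.points i = C ∧ ∀ i, w i ^ 2 * cross (t.points 0) (t.points 1) (t.points 2) ^ 2 =
        r ^ 2 * dist (t.points (i + 1)) (t.points (i + 2)) ^ 2 := by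
  have hcr : ∀ i, cross (t.points i) (t.points (i + 1)) (t.points (i + 2)) =
      cross (t.points 0) (t.points 1) (t.points 2) := by
    intro i
    fin_cases i
    · rfl
    · exact cross_rotate _ _ _
    · exact (cross_rotate _ _ _).symm
  have hd : ∀ i : Fin 3, 0 < dist (t.points (i + 1)) (t.points (i + 2)) := by
    intro i
    refine dist_pos.2 fun h => ?_
    have := t.independent.injective h
    revert this
    fin_cases i <;> decide
  have hH : ∀ i, t.height i ^ 2 * dist (t.points (i + 1)) (t.points (i + 2)) ^ 2 =
      cross (t.points 0) (t.points 1) (t.points 2) ^ 2 := by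
    intro i
    rw [← hcr i]
    exact height_sq_mul_dist_sq_eq_cross_sq t (by fin_cases i <;> decide)
      (by fin_cases i <;> decide)
  have hiff : ∀ (w : Fin 3 → ℝ) (i), 0 < w i → 0 < r → (w i * t.height i = r ↔
      w i ^ 2 * cross (t.points 0) (t.points 1) (t.points 2) ^ 2 =
        r ^ 2 * dist (t.points (i + 1)) (t.points (i + 2)) ^ 2) := by
    intro w i hw hr
    rw [← hH i, ← mul_assoc, ← mul_pow, mul_left_inj' (pow_ne_zero 2 (hd i).ne'),
      pow_left_inj₀ (mul_nonneg hw.le (t.height_pos i).le) hr.le two_ne_zero]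
  have hcomb : ∀ w : Fin 3 → ℝ, ∑ i, w i = 1 →
      Finset.univ.affineCombination ℝ t.points w = ∑ i, w i • t.points i := fun w hw =>
    Finset.univ.affineCombination_eq_linear_combination _ _ hw
  have hspan : ∀ w : Fin 3 → ℝ, ∑ i, w i = 1 →
      ∑ i, w i • t.points i ∈ affineSpan ℝ (Set.range t.points) := by
    intro w hw
    rw [← hcomb w hw]
    exact affineCombination_mem_affineSpan hw _
  have hsd : ∀ (w : Fin 3 → ℝ) (i), ∑ i, w i = 1 →
      t.signedInfDist i (∑ i, w i • t.points i) = w i * t.height i := by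
    intro w i hw
    rw [← hcomb w hw, t.signedInfDist_affineCombination i hw, Affine.Simplex.height,
      dist_eq_norm_vsub]
    rfl
  rw [EuclideanGeometry.Sphere.ext_iff, t.insphere_center, t.insphere_radius]
  constructor
  · rintro ⟨rfl, rfl⟩
    refine ⟨t.inradius_pos, t.excenterWeights ∅, t.excenterWeights_empty_pos, ?_, ?_, ?_⟩
    · simp
    · rw [t.incenter_eq_affineCombination, hcomb _ (by simp)]
    · intro i
      rw [← hiff _ _ (t.excenterWeights_empty_pos i) t.inradius_pos, ← hsd _ _ (by simp),
        ← hcomb _ (by simp), ← t.incenter_eq_affineCombination, t.signedInfDist_incenter]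
  · rintro ⟨hr, w, hw, hs, rfl, h⟩
    have hi : ∀ i, t.signedInfDist i (∑ i, w i • t.points i) = r := fun i => by
      rw [hsd w i hs, hiff w i (hw i) hr]
      exact h i
    have hc := (t.exists_forall_signedInfDist_eq_iff_eq_incenter (hspan w hs)).1 ⟨r, hi⟩
    refine ⟨hc.symm, ?_⟩
    rw [← t.signedInfDist_incenter 0, ← hc, hi 0]

/-- The affine chart of the plane in which the ellipse with semiaxes `a`, `b` is the unit circle. -/
noncomputable def chart (a b : ℝ) (p : Plane) : ℂ := ⟨p 0 / a, p 1 / b⟩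

theorem chart_injective {a b : ℝ} (ha : a ≠ 0) (hb : b ≠ 0) : Function.Injective (chart a b) := by
  intro p q h
  have h0 := congrArg Complex.re h
  have h1 := congrArg Complex.im h
  exact plane_ext ((div_left_inj' ha).1 h0) ((div_left_inj' hb).1 h1)

/-- The inverse of `chart`. -/
noncomputable def unchart (a b : ℝ) (z : ℂ) : Plane := !₂[a * z.re, b * z.im]

theorem chart_unchart {a b : ℝ} (ha : a ≠ 0) (hb : b ≠ 0) (z : ℂ) :
    chart a b (unchart a b z) = z := by
  apply Complex.ext <;> simp [chart, unchart] <;> field_simp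

theorem unchart_chart {a b : ℝ} (ha : a ≠ 0) (hb : b ≠ 0) (p : Plane) :
    unchart a b (chart a b p) = p := by
  apply plane_ext <;> simp [chart, unchart] <;> field_simp

theorem norm_eq_one_iff_sq {z : ℂ} : ‖z‖ = 1 ↔ z.re ^ 2 + z.im ^ 2 = 1 := by
  rw [← sq_eq_sq₀ (norm_nonneg z) zero_le_one, Complex.sq_norm, Complex.normSq_apply, one_pow]
  ring_nf

theorem mem_axisEllipse_iff {a b : ℝ} {p : Plane} : p ∈ axisEllipse a b ↔ ‖chart a b p‖ = 1 := by
  rw [norm_eq_one_iff_sq]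
  rfl

/-- Twice the signed area of a triangle in the complex plane. -/
def crossC (x y z : ℂ) : ℝ := (y.re - x.re) * (z.im - x.im) - (y.im - x.im) * (z.re - x.re)

theorem cross_eq {a b : ℝ} (ha : a ≠ 0) (hb : b ≠ 0) (p q s : Plane) :
    cross p q s = a * b * crossC (chart a b p) (chart a b q) (chart a b s) := by
  simp only [cross, crossC, chart]
  field_simp

/-- `z` is the image in the chart of a triangle with incircle of radius `r` and center `h`. -/
def HasIncircle (a b r : ℝ) (h : ℂ) (z : Fin 3 → ℂ) : Prop :=
  ∃ w : Fin 3 → ℝ, (∀ i, 0 < w i) ∧ ∑ i, w i = 1 ∧ ∑ i, (w i : ℂ) * z i = h ∧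
    ∀ i, w i ^ 2 * (a * b * crossC (z 0) (z 1) (z 2)) ^ 2 =
      r ^ 2 * (a ^ 2 * ((z (i + 1)).re - (z (i + 2)).re) ^ 2 +
        b ^ 2 * ((z (i + 1)).im - (z (i + 2)).im) ^ 2)

/-- Barycentric weights survive the affine chart, so the semiaxes enter only through the area factor
and the side lengths. -/
theorem mem_ponceletFamily_iff {a b : ℝ} (ha : a ≠ 0) (hb : b ≠ 0) {C : Plane} {r : ℝ}
    {t : Affine.Triangle ℝ Plane} :
    t ∈ ponceletFamily a b C r ↔ (∀ i, ‖chart a b (t.points i)‖ = 1) ∧ 0 < r ∧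
      HasIncircle a b r (chart a b C) fun i => chart a b (t.points i) := by
  rw [ponceletFamily, Set.mem_ofPred_eq, insphere_eq_iff, inscribedTriangles, Set.mem_ofPred_eq]
  simp only [mem_axisEllipse_iff]
  refine and_congr_right fun _ => and_congr_right fun _ => exists_congr fun w =>
    and_congr_right fun _ => and_congr_right fun _ => and_congr ?_ (forall_congr' fun i => ?_)
  · have : ∑ i, (w i : ℂ) * chart a b (t.points i) = chart a b (∑ i, w i • t.points i) := by
      apply Complex.ext <;> simp [chart, Fin.sum_univ_three] <;> field_simp
    rw [this]
    exact (chart_injective ha hb).eq_iff.symm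
  · rw [cross_eq ha hb, plane_dist_sq]
    simp only [chart]
    field_simp

theorem exists_triangle {a b : ℝ} (ha : a ≠ 0) (hb : b ≠ 0) {z : Fin 3 → ℂ}
    (hz : crossC (z 0) (z 1) (z 2) ≠ 0) :
    ∃ t : Affine.Triangle ℝ Plane, ∀ i, chart a b (t.points i) = z i := by
  refine ⟨⟨fun i => unchart a b (z i), affineIndependent_of_cross_ne_zero ?_⟩, fun i =>
    chart_unchart ha hb (z i)⟩
  rw [cross_eq ha hb, chart_unchart ha hb, chart_unchart ha hb, chart_unchart ha hb]
  exact mul_ne_zero (mul_ne_zero ha hb) hz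

theorem conj_eq_inv {z : ℂ} (hz : ‖z‖ = 1) : starRingEnd ℂ z = z⁻¹ :=
  (Complex.inv_eq_conj hz).symm

theorem re_cast (z : ℂ) : (z.re : ℂ) = (z + starRingEnd ℂ z) / 2 := Complex.re_eq_add_conj z

theorem im_cast (z : ℂ) : (z.im : ℂ) = (z - starRingEnd ℂ z) / (2 * Complex.I) :=
  Complex.im_eq_sub_conj z

/-- On the unit circle conjugation is inversion, which turns the area into a Vandermonde product
over xyz up to a constant. -/
theorem crossC_sq_of_norm_eq_one {x y z : ℂ} (hx : ‖x‖ = 1) (hy : ‖y‖ = 1) (hz : ‖z‖ = 1) :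
    -4 * (x * y * z) ^ 2 * (crossC x y z : ℂ) ^ 2 = ((x - y) * (y - z) * (z - x)) ^ 2 := by
  have hx0 : x ≠ 0 := norm_ne_zero_iff.1 (by rw [hx]; norm_num)
  have hy0 : y ≠ 0 := norm_ne_zero_iff.1 (by rw [hy]; norm_num)
  have hz0 : z ≠ 0 := norm_ne_zero_iff.1 (by rw [hz]; norm_num)
  have hI : Complex.I ^ 2 = -1 := Complex.I_sq
  have hI0 := Complex.I_ne_zero
  rw [crossC]
  push_cast
  simp only [re_cast, im_cast, conj_eq_inv hx, conj_eq_inv hy, conj_eq_inv hz]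
  field_simp
  rw [hI]
  ring

theorem crossC_ne_zero_of_norm_eq_one {x y z : ℂ} (hx : ‖x‖ = 1) (hy : ‖y‖ = 1) (hz : ‖z‖ = 1)
    (hxy : x ≠ y) (hyz : y ≠ z) (hzx : z ≠ x) : crossC x y z ≠ 0 := by
  intro h
  have := crossC_sq_of_norm_eq_one hx hy hz
  rw [h] at this
  have h2 : ((x - y) * (y - z) * (z - x)) ^ 2 ≠ 0 :=
    pow_ne_zero 2 (mul_ne_zero (mul_ne_zero (sub_ne_zero.2 hxy) (sub_ne_zero.2 hyz))
      (sub_ne_zero.2 hzx))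
  apply h2
  rw [← this]
  simp

/-- The tangency condition in terms of unimodular coordinates. -/
theorem tangency_iff {a b r w k : ℝ} (ha : a ≠ 0) (hb : b ≠ 0) {x y z : ℂ} (hx : ‖x‖ = 1)
    (hy : ‖y‖ = 1) (hz : ‖z‖ = 1) (hyz : y ≠ z)
    (hk : -4 * (x * y * z) ^ 2 * (k : ℂ) ^ 2 = ((x - y) * (y - z) * (z - x)) ^ 2) :
    w ^ 2 * (a * b * k) ^ 2 =
        r ^ 2 * (a ^ 2 * (y.re - z.re) ^ 2 + b ^ 2 * (y.im - z.im) ^ 2) ↔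
      (w : ℂ) ^ 2 * ((x - y) * (x - z)) ^ 2 =
        x ^ 2 * ((2 * r ^ 2 * (1 / a ^ 2 + 1 / b ^ 2) : ℝ) * (y * z) -
          (r ^ 2 * (1 / b ^ 2 - 1 / a ^ 2) : ℝ) * ((y * z) ^ 2 + 1)) := by
  have hx0 : x ≠ 0 := norm_ne_zero_iff.1 (by rw [hx]; norm_num)
  have hy0 : y ≠ 0 := norm_ne_zero_iff.1 (by rw [hy]; norm_num)
  have hz0 : z ≠ 0 := norm_ne_zero_iff.1 (by rw [hz]; norm_num)
  have hI : Complex.I ^ 2 = -1 := Complex.I_sq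
  have hI0 := Complex.I_ne_zero
  have hyz' : y - z ≠ 0 := sub_ne_zero.2 hyz
  have ha' : (a : ℂ) ≠ 0 := Complex.ofReal_ne_zero.2 ha
  have hb' : (b : ℂ) ≠ 0 := Complex.ofReal_ne_zero.2 hb
  -- The squared side length carries the factor (y − z)², as does `hk`. Once it is cancelled, the
  -- right-hand side depends on the side only through yz.
  have e1 : 4 * (y * z) ^ 2 * ((y.re : ℂ) - z.re) ^ 2 = (y - z) ^ 2 * (y * z - 1) ^ 2 := by
    simp only [re_cast, conj_eq_inv hy, conj_eq_inv hz]
    field_simp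
    ring
  have e2 : 4 * (y * z) ^ 2 * ((y.im : ℂ) - z.im) ^ 2 = -((y - z) ^ 2 * (y * z + 1) ^ 2) := by
    simp only [im_cast, conj_eq_inv hy, conj_eq_inv hz]
    field_simp
    rw [hI]
    ring
  rw [← Complex.ofReal_inj]
  push_cast
  have e3 : (x : ℂ) ^ 2 * ((2 * r ^ 2 * (1 / a ^ 2 + 1 / b ^ 2)) * (y * z) -
          (r ^ 2 * (1 / b ^ 2 - 1 / a ^ 2)) * ((y * z) ^ 2 + 1)) * (a * b) ^ 2 =
      x ^ 2 * r ^ 2 * (2 * (a ^ 2 + b ^ 2) * (y * z) - (a ^ 2 - b ^ 2) * ((y * z) ^ 2 + 1)) := by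
    field_simp
    ring
  constructor
  · intro h
    have hne : ((a : ℂ) * b) ^ 2 * (y - z) ^ 2 ≠ 0 := by positivity
    apply mul_right_cancel₀ hne
    rw [← mul_assoc, ← mul_assoc, e3]
    linear_combination (-4) * (x * y * z) ^ 2 * h - w ^ 2 * a ^ 2 * b ^ 2 * hk -
      x ^ 2 * r ^ 2 * a ^ 2 * e1 - x ^ 2 * r ^ 2 * b ^ 2 * e2
  · intro h
    have hne : (-4 : ℂ) * (x * y * z) ^ 2 ≠ 0 := by
      simp [hx0, hy0, hz0]
    apply mul_left_cancel₀ hne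
    linear_combination (a * b) ^ 2 * (y - z) ^ 2 * h + (y - z) ^ 2 * e3 + w ^ 2 * a ^ 2 * b ^ 2 * hk +
      x ^ 2 * r ^ 2 * a ^ 2 * e1 + x ^ 2 * r ^ 2 * b ^ 2 * e2

end Triangles

open ComplexConjugate

/-! ### Algebra of tangency: foci, the cubic of the vertices, the closure relation. -/

section PonceletAlgebra

theorem ne_zero_of_norm_eq_one {z : ℂ} (hz : ‖z‖ = 1) : z ≠ 0 :=
  norm_ne_zero_iff.1 (by rw [hz]; norm_num)

theorem norm_convex_combination_lt_one {l : Fin 3 → ℝ} {z : Fin 3 → ℂ} (hl : ∀ i, 0 < l i)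
    (hs : ∑ i, l i = 1) (hz : ∀ i, ‖z i‖ = 1) (h01 : z 0 ≠ z 1) :
    ‖∑ i, (l i : ℂ) * z i‖ < 1 := by
  have hz' : ∀ i, (z i).re ^ 2 + (z i).im ^ 2 = 1 := fun i => norm_eq_one_iff_sq.1 (hz i)
  rw [← sq_lt_one_iff₀ (norm_nonneg _), Complex.sq_norm, Complex.normSq_apply]
  simp only [Fin.sum_univ_three, Complex.add_re, Complex.add_im, Complex.re_ofReal_mul,
    Complex.im_ofReal_mul] at hs ⊢
  -- For points of the unit circle, 1 − |Σ lᵢzᵢ|² = Σ lᵢlⱼ|zᵢ − zⱼ|² over pairs.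
  have key : 1 - ((l 0 * (z 0).re + l 1 * (z 1).re + l 2 * (z 2).re) ^ 2 +
      (l 0 * (z 0).im + l 1 * (z 1).im + l 2 * (z 2).im) ^ 2) =
      l 0 * l 1 * (((z 0).re - (z 1).re) ^ 2 + ((z 0).im - (z 1).im) ^ 2) +
      l 1 * l 2 * (((z 1).re - (z 2).re) ^ 2 + ((z 1).im - (z 2).im) ^ 2) +
      l 2 * l 0 * (((z 2).re - (z 0).re) ^ 2 + ((z 2).im - (z 0).im) ^ 2) := by
    have hl2 : l 2 = 1 - l 0 - l 1 := by linarith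
    rw [hl2]
    linear_combination (-(l 0)) * hz' 0 - (l 1) * hz' 1 - (1 - l 0 - l 1) * hz' 2
  have hpos : 0 < ((z 0).re - (z 1).re) ^ 2 + ((z 0).im - (z 1).im) ^ 2 := by
    by_contra hcon
    have h1 : (z 0).re - (z 1).re = 0 := by
      nlinarith [sq_nonneg ((z 0).im - (z 1).im), sq_nonneg ((z 0).re - (z 1).re)]
    have h2 : (z 0).im - (z 1).im = 0 := by
      nlinarith [sq_nonneg ((z 0).im - (z 1).im), sq_nonneg ((z 0).re - (z 1).re)]
    exact h01 (Complex.ext (sub_eq_zero.1 h1) (sub_eq_zero.1 h2))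
  have := hl 0
  have := hl 1
  have := hl 2
  have t0 : 0 < l 0 * l 1 * (((z 0).re - (z 1).re) ^ 2 + ((z 0).im - (z 1).im) ^ 2) := by
    positivity
  have t1 : 0 ≤ l 1 * l 2 * (((z 1).re - (z 2).re) ^ 2 + ((z 1).im - (z 2).im) ^ 2) := by
    positivity
  have t2 : 0 ≤ l 2 * l 0 * (((z 2).re - (z 0).re) ^ 2 + ((z 2).im - (z 0).im) ^ 2) := by
    positivity
  nlinarith

/-- A focus of an inscribed ellipse lies inside the triangle, hence inside the disc. The sign of ε
is free, so this covers both foci. -/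
theorem norm_focus_lt_one {a b r ε : ℝ} (hb : 0 < b) (hab : b < a) (hr : 0 < r)
    (hε : ε ^ 2 = r ^ 2 * (1 / b ^ 2 - 1 / a ^ 2)) {h : ℂ} {z : Fin 3 → ℂ}
    (hz : ∀ i, ‖z i‖ = 1) (hinj : Function.Injective z) (hi : HasIncircle a b r h z) :
    ‖h + ε * Complex.I‖ < 1 := by
  obtain ⟨w, hw, hs, hh, hw2⟩ := hi
  have ha : 0 < a := hb.trans hab
  set k := crossC (z 0) (z 1) (z 2) with hk
  have hk0 : k ≠ 0 := crossC_ne_zero_of_norm_eq_one (hz 0) (hz 1) (hz 2)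
    (hinj.ne (by decide)) (hinj.ne (by decide)) (hinj.ne (by decide))
  have hε' : ε ^ 2 * (a ^ 2 * b ^ 2) = r ^ 2 * (a ^ 2 - b ^ 2) := by rw [hε]; field_simp
  -- The second summand of each weight is the barycentric change caused by translation by iε.
  -- Tangency gives wᵢ²k² − ε²Δ² > 0, with Δ the difference of real parts along the opposite side,
  -- so the new weights stay positive.
  have hsum : h + ε * Complex.I =
      ∑ i, ((w i + ε * ((z (i + 2)).re - (z (i + 1)).re) / k : ℝ) : ℂ) * z i := by
    rw [← hh]
    have hk1 : k = ((z 1).re - (z 0).re) * ((z 2).im - (z 0).im) -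
      ((z 1).im - (z 0).im) * ((z 2).re - (z 0).re) := hk
    apply Complex.ext <;>
    simp [Fin.sum_univ_three] <;>
    field_simp <;> rw [hk1] <;> ring
  rw [hsum]
  refine norm_convex_combination_lt_one (fun i => ?_) ?_ hz (hinj.ne (by decide))
  · have hne : z (i + 1) ≠ z (i + 2) := hinj.ne (by fin_cases i <;> decide)
    have hpos : 0 < ((z (i + 1)).re - (z (i + 2)).re) ^ 2 +
        ((z (i + 1)).im - (z (i + 2)).im) ^ 2 := by
      have := Complex.normSq_pos.2 (sub_ne_zero.2 hne)
      rw [Complex.normSq_apply] at this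
      simpa [sq] using this
    have hlt : (ε * ((z (i + 2)).re - (z (i + 1)).re) / k) ^ 2 < w i ^ 2 := by
      rw [div_pow, div_lt_iff₀ (by positivity)]
      refine lt_of_mul_lt_mul_left ?_ (show 0 ≤ a ^ 2 * b ^ 2 by positivity)
      have h1 := hw2 i
      have : 0 < r ^ 2 * b ^ 2 * (((z (i + 1)).re - (z (i + 2)).re) ^ 2 +
        ((z (i + 1)).im - (z (i + 2)).im) ^ 2) := by positivity
      linear_combination this + ((z (i + 2)).re - (z (i + 1)).re) ^ 2 * hε' - h1
    have := abs_lt_of_sq_lt_sq hlt (hw i).le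
    linarith [(abs_lt.1 this).1]
  · rw [Finset.sum_add_distrib, hs]
    simp [Fin.sum_univ_three]
    field_simp
    ring

/-- The weights of the point `h` are read off from the equations of the sides. -/
theorem side_eq {x y z h h' u v w : ℂ} (hx : x ≠ 0) (hy : y ≠ 0) (hz : z ≠ 0)
    (hs : u + v + w = 1) (hh : u * x + v * y + w * z = h) (hh' : u / x + v / y + w / z = h') :
    x * (h + y * z * h' - y - z) = u * ((x - y) * (x - z)) := by
  have hv : v = 1 - u - w := by linear_combination hs
  rw [← hh, ← hh', hv]
  field_simp
  ring

/-- Tangency of a side through x is a quadratic equation in the other endpoint, with roots y and z.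
Vieta's product formula, constant over leading coefficient, is the conclusion; multiplied by x it
becomes the Blaschke equation for l = xyz. -/
theorem lambda_mul_eq {x y z h h' m d : ℂ} (hyz : y ≠ z)
    (hxy : (h + x * y * h' - x - y) ^ 2 = m * (x * y) - d * ((x * y) ^ 2 + 1))
    (hxz : (h + x * z * h' - x - z) ^ 2 = m * (x * z) - d * ((x * z) ^ 2 + 1)) :
    y * z * (1 - 2 * h' * x + (h' ^ 2 + d) * x ^ 2) = x ^ 2 - 2 * h * x + (h ^ 2 + d) := by
  have h1 : (1 - 2 * h' * x + (h' ^ 2 + d) * x ^ 2) * (y + z) +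
      (2 * (h - x) * (x * h' - 1) - m * x) = 0 := by
    apply mul_left_cancel₀ (sub_ne_zero.2 hyz)
    linear_combination hxy - hxz
  linear_combination y * h1 - hxy

/-- The third root need not be checked: the known product and two distinct roots already determine
the cubic. -/
theorem vieta_of_roots {x y z A B l : ℂ} (hx : x ≠ 0) (hy : y ≠ 0) (hxy : x ≠ y)
    (hl : l = x * y * z)
    (h1 : x ^ 3 - A * x ^ 2 + B * x - l = 0) (h2 : y ^ 3 - A * y ^ 2 + B * y - l = 0) :
    x + y + z = A ∧ x * y + y * z + z * x = B := by
  have e1 : (x + y + z - A) * x + (B - (x * y + y * z + z * x)) = 0 := by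
    apply mul_left_cancel₀ hx
    linear_combination h1 + hl
  have e2 : (x + y + z - A) * y + (B - (x * y + y * z + z * x)) = 0 := by
    apply mul_left_cancel₀ hy
    linear_combination h2 + hl
  have e3 : x + y + z - A = 0 := by
    apply mul_left_cancel₀ (sub_ne_zero.2 hxy)
    linear_combination e1 - e2
  constructor
  · linear_combination e3
  · linear_combination x * e3 - e1

/-- The relation between `h`, `d`, `m` that holds when a Poncelet triangle exists. -/
theorem porism_condition {x l h h' m d : ℂ} (hx : x ≠ 0) (hl : l ≠ 0)
    (hD : 1 - 2 * h' * x + (h' ^ 2 + d) * x ^ 2 ≠ 0)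
    (hlD : l * (1 - 2 * h' * x + (h' ^ 2 + d) * x ^ 2) = x * (x ^ 2 - 2 * h * x + (h ^ 2 + d))) :
    (x ^ 2 - h * x - l * ((h' ^ 2 + d) * x - h')) ^ 2 =
        x * l * m - d * (l ^ 2 + x ^ 2) ↔
      1 + (h ^ 2 + d) * (h' ^ 2 + d) = 2 * (h * h') + m := by
  set D := 1 - 2 * h' * x + (h' ^ 2 + d) * x ^ 2 with hDdef
  set N := x ^ 2 - 2 * h * x + (h ^ 2 + d) with hN
  have hG : D * (x ^ 2 - h * x - l * ((h' ^ 2 + d) * x - h')) =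
      x * ((x - h) * D - N * ((h' ^ 2 + d) * x - h')) := by
    linear_combination (-((h' ^ 2 + d) * x - h')) * hlD
  -- The algebraic core: once lD is replaced by xN, the tangency defect factors, and its only factor
  -- that can vanish is free of x and l. This is why closing up does not depend on the starting
  -- point.
  have hpoly : (x * ((x - h) * D - N * ((h' ^ 2 + d) * x - h'))) ^ 2 + d * x ^ 2 * (D ^ 2 + N ^ 2) =
      (1 + (h ^ 2 + d) * (h' ^ 2 + d) - 2 * (h * h')) * x ^ 2 * N * D := by
    rw [hDdef, hN]
    ring
  have key : D ^ 2 * ((x ^ 2 - h * x - l * ((h' ^ 2 + d) * x - h')) ^ 2 -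
      (x * l * m - d * (l ^ 2 + x ^ 2))) =
      D ^ 2 * (x * l * (1 + (h ^ 2 + d) * (h' ^ 2 + d) - 2 * (h * h') - m)) := by
    linear_combination (D * (x ^ 2 - h * x - l * ((h' ^ 2 + d) * x - h')) +
      x * ((x - h) * D - N * ((h' ^ 2 + d) * x - h'))) * hG + hpoly +
      d * (l * D + x * N) * hlD -
      (1 + (h ^ 2 + d) * (h' ^ 2 + d) - 2 * (h * h')) * x * D * hlD
  have key2 := mul_left_cancel₀ (pow_ne_zero 2 hD) key
  constructor
  · intro h1
    rw [h1, sub_self] at key2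
    have := (mul_eq_zero.1 key2.symm).resolve_left (mul_ne_zero hx hl)
    linear_combination this
  · intro h1
    have h2 : 1 + (h ^ 2 + d) * (h' ^ 2 + d) - 2 * (h * h') - m = 0 := by linear_combination h1
    rw [h2, mul_zero] at key2
    linear_combination key2

end PonceletAlgebra

/-! ### Blaschke products of degree three. -/

section Blaschke

theorem exists_cubic_roots (A B l : ℂ) : ∃ x y z : ℂ,
    x + y + z = A ∧ x * y + y * z + z * x = B ∧ x * y * z = l := by
  obtain ⟨x, hx⟩ := IsAlgClosed.exists_root
    (Polynomial.X ^ 3 - Polynomial.C A * Polynomial.X ^ 2 + Polynomial.C B * Polynomial.X -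
      Polynomial.C l) (by
        rw [show (Polynomial.X ^ 3 - Polynomial.C A * Polynomial.X ^ 2 +
          Polynomial.C B * Polynomial.X - Polynomial.C l : Polynomial ℂ).degree = 3 by
            compute_degree!]
        norm_num)
  simp only [Polynomial.IsRoot, Polynomial.eval_sub, Polynomial.eval_add, Polynomial.eval_pow,
    Polynomial.eval_mul, Polynomial.eval_X, Polynomial.eval_C] at hx
  obtain ⟨s, hs⟩ := IsAlgClosed.exists_pow_nat_eq ((A - x) ^ 2 - 4 * (B - x * (A - x)))
    (zero_lt_two)
  refine ⟨x, ((A - x) + s) / 2, ((A - x) - s) / 2, by ring, by linear_combination (-1 / 4) * hs, ?_⟩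
  linear_combination (-x / 4) * hs + hx

theorem exists_cubic_roots_of_root {A B l x : ℂ} (hx : x ^ 3 - A * x ^ 2 + B * x - l = 0) :
    ∃ y z : ℂ, x + y + z = A ∧ x * y + y * z + z * x = B ∧ x * y * z = l := by
  obtain ⟨s, hs⟩ := IsAlgClosed.exists_pow_nat_eq ((A - x) ^ 2 - 4 * (B - x * (A - x)))
    (zero_lt_two)
  refine ⟨((A - x) + s) / 2, ((A - x) - s) / 2, by ring, by linear_combination (-1 / 4) * hs, ?_⟩
  linear_combination (-x / 4) * hs + hx

theorem norm_sq_one_sub_conj_mul (f x : ℂ) :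
    ‖1 - conj f * x‖ ^ 2 - ‖x - f‖ ^ 2 = (1 - ‖f‖ ^ 2) * (1 - ‖x‖ ^ 2) := by
  simp only [Complex.sq_norm, Complex.normSq_apply]
  simp
  ring

theorem one_sub_conj_mul_ne_zero {f x : ℂ} (hf : ‖f‖ < 1) (hx : ‖x‖ = 1) : 1 - conj f * x ≠ 0 := by
  intro h
  have h1 : conj f * x = 1 := (sub_eq_zero.1 h).symm
  have := congrArg norm h1
  rw [norm_mul, RCLike.norm_conj, hx, norm_one] at this
  linarith

/-- The solutions of the equation `B x = l` lie on the unit circle for every Blaschke product `B`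
of degree three with a zero at the origin and every `l` on the unit circle. -/
theorem norm_eq_one_of_blaschke {f g l x : ℂ} (hf : ‖f‖ < 1) (hg : ‖g‖ < 1) (hl : ‖l‖ = 1)
    (h : l * ((1 - conj f * x) * (1 - conj g * x)) = x * ((x - f) * (x - g))) : ‖x‖ = 1 := by
  have hn := congrArg norm h
  rw [norm_mul, norm_mul, norm_mul, norm_mul, hl, one_mul] at hn
  have h1 := norm_sq_one_sub_conj_mul f x
  have h2 := norm_sq_one_sub_conj_mul g x
  have hf2 : 0 < 1 - ‖f‖ ^ 2 := by nlinarith [norm_nonneg f]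
  have hg2 : 0 < 1 - ‖g‖ ^ 2 := by nlinarith [norm_nonneg g]
  -- By `h1` and `h2` each factor |x − f|/|1 − f̄x| lies on the same side of 1 as |x|, so off the
  -- circle the two sides of the equation have different moduli.
  rcases lt_trichotomy ‖x‖ 1 with hx | hx | hx
  · have hx2 : 0 < 1 - ‖x‖ ^ 2 := by nlinarith [norm_nonneg x]
    have p1 := mul_pos hf2 hx2
    have p2 := mul_pos hg2 hx2
    have l1 : ‖x - f‖ < ‖1 - conj f * x‖ :=
      lt_of_pow_lt_pow_left₀ 2 (norm_nonneg _) (by linarith)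
    have l2 : ‖x - g‖ < ‖1 - conj g * x‖ :=
      lt_of_pow_lt_pow_left₀ 2 (norm_nonneg _) (by linarith)
    have l3 : ‖x - f‖ * ‖x - g‖ < ‖1 - conj f * x‖ * ‖1 - conj g * x‖ :=
      mul_lt_mul'' l1 l2 (norm_nonneg _) (norm_nonneg _)
    have l4 : ‖x‖ * (‖x - f‖ * ‖x - g‖) ≤ ‖x - f‖ * ‖x - g‖ :=
      mul_le_of_le_one_left (by positivity) hx.le
    linarith
  · exact hx
  · have hx2 : 0 < ‖x‖ ^ 2 - 1 := by nlinarith [norm_nonneg x]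
    have p1 := mul_pos hf2 hx2
    have p2 := mul_pos hg2 hx2
    have l1 : ‖1 - conj f * x‖ < ‖x - f‖ :=
      lt_of_pow_lt_pow_left₀ 2 (norm_nonneg _) (by linarith)
    have l2 : ‖1 - conj g * x‖ < ‖x - g‖ :=
      lt_of_pow_lt_pow_left₀ 2 (norm_nonneg _) (by linarith)
    have l3 : ‖1 - conj f * x‖ * ‖1 - conj g * x‖ < ‖x - f‖ * ‖x - g‖ :=
      mul_lt_mul'' l1 l2 (norm_nonneg _) (norm_nonneg _)
    have l4 : ‖x - f‖ * ‖x - g‖ ≤ ‖x‖ * (‖x - f‖ * ‖x - g‖) :=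
      le_mul_of_one_le_left (by positivity) hx.le
    linarith

theorem one_sub_conj_mul_eq {f x : ℂ} (hx : ‖x‖ = 1) : 1 - conj f * x = x * conj (x - f) := by
  rw [map_sub, conj_eq_inv hx, mul_sub, mul_inv_cancel₀ (ne_zero_of_norm_eq_one hx)]
  ring

/-- The derivative of the Blaschke product does not vanish, and the barycentric coordinate of
`(f + g) / 2` with respect to `x` in the triangle `x`, `y`, `z` is positive. -/
theorem blaschke_weight {f g l x y z : ℂ} (hf : ‖f‖ < 1) (hg : ‖g‖ < 1) (hx : ‖x‖ = 1)
    (hl : x * y * z = l) (he1 : x + y + z = f + g + l * (conj f * conj g))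
    (he2 : x * y + y * z + z * x = f * g + l * (conj f + conj g)) :
    (x - y) * (x - z) ≠ 0 ∧ ∃ w : ℝ, 0 < w ∧ (w : ℂ) * ((x - y) * (x - z)) =
      x * ((f + g) / 2 + y * z * ((conj f + conj g) / 2) - y - z) := by
  set D := (1 - conj f * x) * (1 - conj g * x) with hD
  have hx0 := ne_zero_of_norm_eq_one hx
  have hD0 : D ≠ 0 := mul_ne_zero (one_sub_conj_mul_ne_zero hf hx) (one_sub_conj_mul_ne_zero hg hx)
  have hlD : l * D = x * ((x - f) * (x - g)) := by
    rw [hD]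
    linear_combination (-x ^ 2) * he1 + x * he2 - hl
  -- The logarithmic derivative: xB′(x)/B(x) = 1 + (1 − |f|²)/|x − f|² + (1 − |g|²)/|x − g|² = (n +
  -- q)/n on the circle. The cubic x(x − f)(x − g) − lD has derivative (x − y)(x − z) at x, and the
  -- weight comes out as q/(2(n + q)).
  set q := (1 - ‖f‖ ^ 2) * ‖x - g‖ ^ 2 + (1 - ‖g‖ ^ 2) * ‖x - f‖ ^ 2 with hq
  set n := ‖(x - f) * (x - g)‖ ^ 2 with hn
  have hqc : (q : ℂ) * x = (1 - f * conj f) * ((x - g) * (1 - conj g * x)) +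
      (1 - g * conj g) * ((x - f) * (1 - conj f * x)) := by
    rw [hq, one_sub_conj_mul_eq hx, one_sub_conj_mul_eq hx]
    push_cast
    simp only [← Complex.mul_conj']
    ring
  have hnc : (n : ℂ) * x ^ 2 = D * ((x - f) * (x - g)) := by
    rw [hn, hD, one_sub_conj_mul_eq hx, one_sub_conj_mul_eq hx]
    push_cast
    rw [← Complex.mul_conj', map_mul]
    ring
  have hder : D * ((x - y) * (x - z)) = x ^ 2 * ((n + q : ℝ) : ℂ) := by
    push_cast
    rw [hD] at hlD hnc ⊢
    linear_combination (conj f + conj g - 2 * conj f * conj g * x) * hlD - hnc - x * hqc +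
      (1 - conj f * x) * (1 - conj g * x) * (he2 - 2 * x * he1)
  have hside : D * (x * ((f + g) / 2 + y * z * ((conj f + conj g) / 2) - y - z)) =
      x ^ 2 * ((q / 2 : ℝ) : ℂ) := by
    push_cast
    rw [hD] at hlD ⊢
    linear_combination ((conj f + conj g) / 2 - conj f * conj g * x) * hlD - x / 2 * hqc +
      (1 - conj f * x) * (1 - conj g * x) * ((conj f + conj g) / 2 * hl - x * he1)
  have hf2 : 0 < 1 - ‖f‖ ^ 2 := by nlinarith [norm_nonneg f]
  have hg2 : 0 < 1 - ‖g‖ ^ 2 := by nlinarith [norm_nonneg g]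
  have hxg : 0 < ‖x - g‖ := norm_pos_iff.2 (sub_ne_zero.2 fun h => by rw [h] at hx; linarith)
  have hq0 : 0 < q := by positivity
  have hn0 : 0 ≤ n := by positivity
  have hnq : 0 < n + q := by linarith
  have hnqc : ((n + q : ℝ) : ℂ) ≠ 0 := Complex.ofReal_ne_zero.2 hnq.ne'
  refine ⟨fun h => ?_, q / 2 / (n + q), by positivity, ?_⟩
  · rw [h, mul_zero] at hder
    exact mul_ne_zero (pow_ne_zero 2 hx0) hnqc hder.symm
  · apply mul_left_cancel₀ hD0
    rw [hside, mul_left_comm, hder, Complex.ofReal_div]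
    field_simp

end Blaschke

/-! ### Poncelet's porism: tangency is equivalent to the Blaschke equation. -/

section Porism

/-- The square of half the focal distance of the image of a circle of radius `r` in the chart. -/
noncomputable def focalSq (a b r : ℝ) : ℝ := r ^ 2 * (1 / b ^ 2 - 1 / a ^ 2)

/-- The product of the foci of the image in the chart of a circle. -/
noncomputable def fociProd (a b r : ℝ) (h : ℂ) : ℂ := h ^ 2 + (focalSq a b r : ℂ)

/-- The circle of radius `r` whose center has image `h` in the chart is the incircle of a
one-parameter family of triangles inscribed in the ellipse with semiaxes `a`, `b`. -/
structure IsPoristic (a b r : ℝ) (h : ℂ) : Prop where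
  r_pos : 0 < r
  norm_add_lt : ‖h + (√(focalSq a b r) : ℝ) * Complex.I‖ < 1
  norm_sub_lt : ‖h - (√(focalSq a b r) : ℝ) * Complex.I‖ < 1
  condition : 1 + ‖fociProd a b r h‖ ^ 2 =
    2 * ‖h‖ ^ 2 + 2 * r ^ 2 * (1 / a ^ 2 + 1 / b ^ 2)

variable {a b r : ℝ} {h : ℂ} {z : Fin 3 → ℂ}

theorem focalSq_nonneg (hb : 0 < b) (hab : b < a) : 0 ≤ focalSq a b r := by
  have : 1 / a ^ 2 ≤ 1 / b ^ 2 := by gcongr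
  have h2 : 0 ≤ 1 / b ^ 2 - 1 / a ^ 2 := by linarith
  exact mul_nonneg (sq_nonneg r) h2

theorem focus_sq (hb : 0 < b) (hab : b < a) :
    ((√(focalSq a b r) : ℝ) * Complex.I) ^ 2 = -(focalSq a b r : ℂ) := by
  rw [mul_pow, Complex.I_sq, ← Complex.ofReal_pow, Real.sq_sqrt (focalSq_nonneg hb hab)]
  ring

theorem foci_mul (hb : 0 < b) (hab : b < a) :
    (h + (√(focalSq a b r) : ℝ) * Complex.I) * (h - (√(focalSq a b r) : ℝ) * Complex.I) =
      fociProd a b r h := by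
  rw [fociProd]
  linear_combination -focus_sq hb hab

theorem norm_fociProd_lt_one (hb : 0 < b) (hab : b < a) (hp : IsPoristic a b r h) :
    ‖fociProd a b r h‖ < 1 := by
  rw [← foci_mul hb hab, norm_mul]
  nlinarith [hp.norm_add_lt, hp.norm_sub_lt, norm_nonneg (h + (√(focalSq a b r) : ℝ) * Complex.I),
    norm_nonneg (h - (√(focalSq a b r) : ℝ) * Complex.I)]

theorem conj_fociProd : conj (fociProd a b r h) = conj h ^ 2 + (focalSq a b r : ℂ) := by
  simp [fociProd]

theorem condition_iff_complex :
    1 + ‖fociProd a b r h‖ ^ 2 = 2 * ‖h‖ ^ 2 + 2 * r ^ 2 * (1 / a ^ 2 + 1 / b ^ 2) ↔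
    1 + (h ^ 2 + (focalSq a b r : ℂ)) * (conj h ^ 2 + (focalSq a b r : ℂ)) =
      2 * (h * conj h) + (2 * r ^ 2 * (1 / a ^ 2 + 1 / b ^ 2) : ℝ) := by
  rw [← conj_fociProd, ← fociProd, Complex.mul_conj', Complex.mul_conj', ← Complex.ofReal_inj]
  push_cast
  rfl

/-- `side_eq` eliminates the weights, leaving one equation per side. Two of the vertices then
satisfy the Blaschke cubic, which gives the sum by Vieta; the side opposite x, rewritten at the root
x, gives the closure relation. -/
theorem sum_and_condition {x y z u v w l h h' m d : ℂ} (hx : x ≠ 0) (hy : y ≠ 0) (hz : z ≠ 0)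
    (hxy : x ≠ y) (hyz : y ≠ z) (hzx : z ≠ x) (hl : l = x * y * z)
    (hD : 1 - 2 * h' * x + (h' ^ 2 + d) * x ^ 2 ≠ 0)
    (hs : u + v + w = 1) (hh : u * x + v * y + w * z = h) (hh' : u / x + v / y + w / z = h')
    (hu : u ^ 2 * ((x - y) * (x - z)) ^ 2 = x ^ 2 * (m * (y * z) - d * ((y * z) ^ 2 + 1)))
    (hv : v ^ 2 * ((y - z) * (y - x)) ^ 2 = y ^ 2 * (m * (z * x) - d * ((z * x) ^ 2 + 1)))
    (hw : w ^ 2 * ((z - x) * (z - y)) ^ 2 = z ^ 2 * (m * (x * y) - d * ((x * y) ^ 2 + 1))) :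
    x + y + z = 2 * h + l * (h' ^ 2 + d) ∧
      1 + (h ^ 2 + d) * (h' ^ 2 + d) = 2 * (h * h') + m := by
  have su := side_eq hx hy hz hs hh hh'
  have sv := side_eq (u := v) (v := w) (w := u) (h := h) (h' := h') hy hz hx
    (by linear_combination hs) (by linear_combination hh) (by linear_combination hh')
  have sw := side_eq (u := w) (v := u) (w := v) (h := h) (h' := h') hz hx hy
    (by linear_combination hs) (by linear_combination hh) (by linear_combination hh')
  have qu : (h + y * z * h' - y - z) ^ 2 = m * (y * z) - d * ((y * z) ^ 2 + 1) := by
    apply mul_left_cancel₀ (pow_ne_zero 2 hx)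
    rw [← hu, ← mul_pow, su, mul_pow]
  have qv : (h + z * x * h' - z - x) ^ 2 = m * (z * x) - d * ((z * x) ^ 2 + 1) := by
    apply mul_left_cancel₀ (pow_ne_zero 2 hy)
    rw [← hv, ← mul_pow, sv, mul_pow]
  have qw : (h + x * y * h' - x - y) ^ 2 = m * (x * y) - d * ((x * y) ^ 2 + 1) := by
    apply mul_left_cancel₀ (pow_ne_zero 2 hz)
    rw [← hw, ← mul_pow, sw, mul_pow]
  have lx := lambda_mul_eq (x := x) (h := h) (h' := h') (m := m) (d := d) hyz qw
    (by linear_combination qv)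
  have ly := lambda_mul_eq (x := y) (h := h) (h' := h') (m := m) (d := d) hzx qu
    (by linear_combination qw)
  obtain ⟨e1, e2⟩ := vieta_of_roots (A := 2 * h + l * (h' ^ 2 + d))
    (B := h ^ 2 + d + l * (2 * h')) hx hy hxy hl
    (by rw [hl]; linear_combination (-x) * lx) (by rw [hl]; linear_combination (-y) * ly)
  refine ⟨e1, (porism_condition (x := x) (l := l) hx ?_ hD ?_).1 ?_⟩
  · rw [hl]
    exact mul_ne_zero (mul_ne_zero hx hy) hz
  · rw [hl]
    linear_combination x * lx
  · have h1 : x * (h + y * z * h' - y - z) = x ^ 2 - h * x - l * ((h' ^ 2 + d) * x - h') := by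
      linear_combination (-x) * e1 - h' * hl
    rw [← h1, mul_pow, qu, hl]
    ring

theorem chart_denominator_ne_zero (hb : 0 < b) (hab : b < a)
    (h1 : ‖h + (√(focalSq a b r) : ℝ) * Complex.I‖ < 1)
    (h2 : ‖h - (√(focalSq a b r) : ℝ) * Complex.I‖ < 1) {x : ℂ} (hx : ‖x‖ = 1) :
    1 - 2 * conj h * x + (conj h ^ 2 + (focalSq a b r : ℂ)) * x ^ 2 ≠ 0 := by
  have := mul_ne_zero (one_sub_conj_mul_ne_zero h1 hx) (one_sub_conj_mul_ne_zero h2 hx)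
  intro h0
  apply this
  rw [← h0]
  -- The denominator is (1 − f̄x)(1 − ḡx).
  simp only [map_add, map_sub, map_mul, Complex.conj_ofReal, Complex.conj_I]
  linear_combination (-x ^ 2) * focus_sq (r := r) hb hab

theorem HasIncircle.isPoristic_and_sum (hb : 0 < b) (hab : b < a) (hr : 0 < r)
    (hz : ∀ i, ‖z i‖ = 1) (hinj : Function.Injective z) (hi : HasIncircle a b r h z) :
    IsPoristic a b r h ∧
      z 0 + z 1 + z 2 = 2 * h + z 0 * z 1 * z 2 * conj (fociProd a b r h) := by
  have ha : 0 < a := hb.trans hab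
  have f1 := norm_focus_lt_one (ε := √(focalSq a b r)) hb hab hr
    (Real.sq_sqrt (focalSq_nonneg hb hab)) hz hinj hi
  have f2 := norm_focus_lt_one (ε := -√(focalSq a b r)) hb hab hr
    (by rw [neg_sq]; exact Real.sq_sqrt (focalSq_nonneg hb hab)) hz hinj hi
  rw [Complex.ofReal_neg, neg_mul, ← sub_eq_add_neg] at f2
  obtain ⟨w, hw, hs, hh, hw2⟩ := hi
  have h01 : z 0 ≠ z 1 := hinj.ne (by decide)
  have h12 : z 1 ≠ z 2 := hinj.ne (by decide)
  have h20 : z 2 ≠ z 0 := hinj.ne (by decide)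
  have hc := crossC_sq_of_norm_eq_one (hz 0) (hz 1) (hz 2)
  have t0 := (tangency_iff (r := r) (w := w 0) ha.ne' hb.ne' (hz 0) (hz 1) (hz 2) h12 hc).1 (hw2 0)
  have t1 := (tangency_iff (r := r) (w := w 1) ha.ne' hb.ne' (hz 1) (hz 2) (hz 0) h20
    (by linear_combination hc)).1 (hw2 1)
  have t2 := (tangency_iff (r := r) (w := w 2) ha.ne' hb.ne' (hz 2) (hz 0) (hz 1) h01
    (by linear_combination hc)).1 (hw2 2)
  rw [Fin.sum_univ_three] at hs hh
  have hh' : (w 0 : ℂ) / z 0 + w 1 / z 1 + w 2 / z 2 = conj h := by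
    rw [← hh]
    simp only [map_add, map_mul, Complex.conj_ofReal, conj_eq_inv (hz _)]
    ring
  obtain ⟨e1, cond⟩ := sum_and_condition (l := z 0 * z 1 * z 2)
    (m := (2 * r ^ 2 * (1 / a ^ 2 + 1 / b ^ 2) : ℝ)) (d := (focalSq a b r : ℂ))
    (ne_zero_of_norm_eq_one (hz 0))
    (ne_zero_of_norm_eq_one (hz 1)) (ne_zero_of_norm_eq_one (hz 2)) h01 h12 h20 rfl
    (chart_denominator_ne_zero hb hab f1 f2 (hz 0)) (by exact_mod_cast hs) hh hh' t0 t1 t2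
  rw [conj_fociProd]
  exact ⟨⟨hr, f1, f2, condition_iff_complex.2 cond⟩, e1⟩

theorem sum_mul_eq_of_norm_eq_one {x y z : ℂ} (hx : ‖x‖ = 1) (hy : ‖y‖ = 1) (hz : ‖z‖ = 1) :
    x * y + y * z + z * x = x * y * z * conj (x + y + z) := by
  have := ne_zero_of_norm_eq_one hx
  have := ne_zero_of_norm_eq_one hy
  have := ne_zero_of_norm_eq_one hz
  simp only [map_add, conj_eq_inv hx, conj_eq_inv hy, conj_eq_inv hz]
  field_simp
  ring

/-- Unimodular numbers satisfy e₂ = e₃ · conj e₁, so the equation for the sum alone determines the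
whole cubic. -/
theorem sum_mul_eq (hz : ∀ i, ‖z i‖ = 1)
    (hsum : z 0 + z 1 + z 2 = 2 * h + z 0 * z 1 * z 2 * conj (fociProd a b r h)) :
    z 0 * z 1 + z 1 * z 2 + z 2 * z 0 = fociProd a b r h + z 0 * z 1 * z 2 * (2 * conj h) := by
  have h0 := ne_zero_of_norm_eq_one (hz 0)
  have h1 := ne_zero_of_norm_eq_one (hz 1)
  have h2 := ne_zero_of_norm_eq_one (hz 2)
  rw [sum_mul_eq_of_norm_eq_one (hz 0) (hz 1) (hz 2), hsum]
  simp only [map_add, map_mul, map_ofNat, conj_eq_inv (hz _), Complex.conj_conj]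
  field_simp
  ring

/-- The converse half of the porism. `blaschke_weight` supplies distinct vertices and positive
weights, and `porism_condition`, read backwards, supplies tangency at each vertex because its
right-hand side mentions no vertex. -/
theorem injective_and_hasIncircle (hb : 0 < b) (hab : b < a) (hp : IsPoristic a b r h)
    (hz : ∀ i, ‖z i‖ = 1)
    (hsum : z 0 + z 1 + z 2 = 2 * h + z 0 * z 1 * z 2 * conj (fociProd a b r h)) :
    Function.Injective z ∧ HasIncircle a b r h z := by
  have ha : 0 < a := hb.trans hab
  have hmul := sum_mul_eq hz hsum
  set f := h + (√(focalSq a b r) : ℝ) * Complex.I with hf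
  set g := h - (√(focalSq a b r) : ℝ) * Complex.I with hg
  have hfg : f + g = 2 * h := by rw [hf, hg]; ring
  have hfg' : conj f + conj g = 2 * conj h := by rw [← map_add, hfg, map_mul, map_ofNat]
  have hfgm : f * g = fociProd a b r h := foci_mul hb hab
  have hfgm' : conj f * conj g = conj (fociProd a b r h) := by rw [← map_mul, hfgm]
  have key : ∀ i, (z i - z (i + 1)) * (z i - z (i + 2)) ≠ 0 ∧ ∃ w : ℝ, 0 < w ∧
      (w : ℂ) * ((z i - z (i + 1)) * (z i - z (i + 2))) =
        z i * (h + z (i + 1) * z (i + 2) * conj h - z (i + 1) - z (i + 2)) := by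
    intro i
    have hperm : z i * z (i + 1) * z (i + 2) = z 0 * z 1 * z 2 ∧
        z i + z (i + 1) + z (i + 2) = z 0 + z 1 + z 2 ∧
        z i * z (i + 1) + z (i + 1) * z (i + 2) + z (i + 2) * z i =
          z 0 * z 1 + z 1 * z 2 + z 2 * z 0 := by
      fin_cases i
      · exact ⟨rfl, rfl, rfl⟩
      · exact ⟨show z 1 * z 2 * z 0 = _ by ring, show z 1 + z 2 + z 0 = _ by ring,
          show z 1 * z 2 + z 2 * z 0 + z 0 * z 1 = _ by ring⟩
      · exact ⟨show z 2 * z 0 * z 1 = _ by ring, show z 2 + z 0 + z 1 = _ by ring,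
          show z 2 * z 0 + z 0 * z 1 + z 1 * z 2 = _ by ring⟩
    have := blaschke_weight (f := f) (g := g) (l := z 0 * z 1 * z 2) (x := z i) (y := z (i + 1))
      (z := z (i + 2)) hp.norm_add_lt hp.norm_sub_lt (hz i) hperm.1
      (by rw [hperm.2.1, hsum, hfg, hfgm']) (by rw [hperm.2.2, hmul, hfgm, hfg'])
    rw [hfg, hfg', mul_div_cancel_left₀ _ two_ne_zero, mul_div_cancel_left₀ _ two_ne_zero] at this
    exact this
  choose hne w hw hweq using key
  have h01 : z 0 - z 1 ≠ 0 := left_ne_zero_of_mul (hne 0)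
  have h12 : z 1 - z 2 ≠ 0 := left_ne_zero_of_mul (hne 1)
  have h20 : z 2 - z 0 ≠ 0 := left_ne_zero_of_mul (hne 2)
  have h10 : z 1 - z 0 ≠ 0 := right_ne_zero_of_mul (hne 1)
  have h21 : z 2 - z 1 ≠ 0 := right_ne_zero_of_mul (hne 2)
  have h02 : z 0 - z 2 ≠ 0 := right_ne_zero_of_mul (hne 0)
  have w0 : (w 0 : ℂ) = z 0 * (h + z 1 * z 2 * conj h - z 1 - z 2) /
      ((z 0 - z 1) * (z 0 - z 2)) := eq_div_of_mul_eq (hne 0) (hweq 0)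
  have w1 : (w 1 : ℂ) = z 1 * (h + z 2 * z 0 * conj h - z 2 - z 0) /
      ((z 0 - z 1) * (z 2 - z 1)) := by
    refine eq_div_of_mul_eq (mul_ne_zero h01 h21) ?_
    have : (w 1 : ℂ) * ((z 1 - z 2) * (z 1 - z 0)) = z 1 * (h + z 2 * z 0 * conj h - z 2 - z 0) :=
      hweq 1
    linear_combination this
  have w2 : (w 2 : ℂ) = z 2 * (h + z 0 * z 1 * conj h - z 0 - z 1) /
      ((z 0 - z 2) * (z 1 - z 2)) := by
    refine eq_div_of_mul_eq (mul_ne_zero h02 h12) ?_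
    have : (w 2 : ℂ) * ((z 2 - z 0) * (z 2 - z 1)) = z 2 * (h + z 0 * z 1 * conj h - z 0 - z 1) :=
      hweq 2
    linear_combination this
  have hinj : Function.Injective z := by
    intro i j hij
    by_contra hne'
    fin_cases i <;> fin_cases j <;> simp_all
  refine ⟨hinj, w, hw, ?_, ?_, fun i => ?_⟩
  · rw [← Complex.ofReal_inj, Fin.sum_univ_three]
    push_cast
    rw [w0, w1, w2, ← neg_sub (z 1) (z 2)]
    field_simp
    ring
  · rw [Fin.sum_univ_three, w0, w1, w2, ← neg_sub (z 1) (z 2)]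
    field_simp
    ring
  · have hc := crossC_sq_of_norm_eq_one (hz 0) (hz 1) (hz 2)
    have hperm : z i * z (i + 1) * z (i + 2) = z 0 * z 1 * z 2 ∧
        z i + z (i + 1) + z (i + 2) = z 0 + z 1 + z 2 ∧
        ((z i - z (i + 1)) * (z (i + 1) - z (i + 2)) * (z (i + 2) - z i)) ^ 2 =
          ((z 0 - z 1) * (z 1 - z 2) * (z 2 - z 0)) ^ 2 := by
      fin_cases i
      · exact ⟨rfl, rfl, rfl⟩
      · exact ⟨show z 1 * z 2 * z 0 = _ by ring, show z 1 + z 2 + z 0 = _ by ring,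
          show ((z 1 - z 2) * (z 2 - z 0) * (z 0 - z 1)) ^ 2 = _ by ring⟩
      · exact ⟨show z 2 * z 0 * z 1 = _ by ring, show z 2 + z 0 + z 1 = _ by ring,
          show ((z 2 - z 0) * (z 0 - z 1) * (z 1 - z 2)) ^ 2 = _ by ring⟩
    obtain ⟨p1, p2, p3⟩ := hperm
    rw [tangency_iff ha.ne' hb.ne' (hz i) (hz (i + 1)) (hz (i + 2))
      (hinj.ne (by fin_cases i <;> decide)) (by rw [p1, p3]; exact hc)]
    rw [← mul_pow, hweq i]
    have hl0 : z 0 * z 1 * z 2 ≠ 0 := mul_ne_zero (mul_ne_zero (ne_zero_of_norm_eq_one (hz 0))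
      (ne_zero_of_norm_eq_one (hz 1))) (ne_zero_of_norm_eq_one (hz 2))
    rw [conj_fociProd] at hsum
    rw [fociProd] at hmul
    have hroot : z i ^ 3 - (z 0 + z 1 + z 2) * z i ^ 2 +
        (z 0 * z 1 + z 1 * z 2 + z 2 * z 0) * z i - z 0 * z 1 * z 2 = 0 := by
      fin_cases i <;> simp <;> ring
    have hpc := (porism_condition (x := z i) (l := z 0 * z 1 * z 2) (h := h) (h' := conj h)
      (d := (focalSq a b r : ℂ)) (m := (2 * r ^ 2 * (1 / a ^ 2 + 1 / b ^ 2) : ℝ))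
      (ne_zero_of_norm_eq_one (hz i)) hl0
      (chart_denominator_ne_zero hb hab hp.norm_add_lt hp.norm_sub_lt (hz i))
      (by linear_combination (-1 : ℂ) * hroot - z i ^ 2 * hsum + z i * hmul)).2
      (condition_iff_complex.1 hp.condition)
    have h1 : z i * (h + z (i + 1) * z (i + 2) * conj h - z (i + 1) - z (i + 2)) =
        z i ^ 2 - h * z i - z 0 * z 1 * z 2 * ((conj h ^ 2 + (focalSq a b r : ℂ)) * z i - conj h) := by
      linear_combination conj h * p1 - z i * p2 - z i * hsum
    rw [h1, hpc, ← p1, focalSq]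
    ring

end Porism

/-! ### The family parametrized by the product of the vertices. -/

section Family

variable {a b r : ℝ} {C : Plane}

theorem fin_triple_norm {x y z : ℂ} (hx : ‖x‖ = 1) (hy : ‖y‖ = 1) (hz : ‖z‖ = 1) :
    ∀ i, ‖(![x, y, z] : Fin 3 → ℂ) i‖ = 1 := by
  intro i
  fin_cases i
  · exact hx
  · exact hy
  · exact hz

theorem root_norm_eq_one {h l x : ℂ} (hb : 0 < b) (hab : b < a) (hp : IsPoristic a b r h)
    (hl : ‖l‖ = 1)
    (hx : x ^ 3 - (2 * h + l * conj (fociProd a b r h)) * x ^ 2 +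
      (fociProd a b r h + l * (2 * conj h)) * x - l = 0) : ‖x‖ = 1 := by
  refine norm_eq_one_of_blaschke hp.norm_add_lt hp.norm_sub_lt hl ?_
  rw [conj_fociProd, fociProd] at hx
  simp only [map_add, map_sub, map_mul, Complex.conj_ofReal, Complex.conj_I]
  linear_combination (-1 : ℂ) * hx - (l * x ^ 2 - x) * focus_sq (r := r) hb hab

theorem roots_of_symm {A B l x y z : ℂ} (h1 : x + y + z = A) (h2 : x * y + y * z + z * x = B)
    (h3 : x * y * z = l) : x ^ 3 - A * x ^ 2 + B * x - l = 0 ∧ y ^ 3 - A * y ^ 2 + B * y - l = 0 ∧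
      z ^ 3 - A * z ^ 2 + B * z - l = 0 := by
  rw [← h1, ← h2, ← h3]
  refine ⟨by ring, by ring, by ring⟩

theorem exists_triple_of_prod {h l : ℂ} (hb : 0 < b) (hab : b < a) (hp : IsPoristic a b r h)
    (hl : ‖l‖ = 1) : ∃ z : Fin 3 → ℂ, (∀ i, ‖z i‖ = 1) ∧ z 0 * z 1 * z 2 = l ∧
      z 0 + z 1 + z 2 = 2 * h + z 0 * z 1 * z 2 * conj (fociProd a b r h) := by
  obtain ⟨x, y, z, h1, h2, h3⟩ := exists_cubic_roots (2 * h + l * conj (fociProd a b r h))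
    (fociProd a b r h + l * (2 * conj h)) l
  obtain ⟨rx, ry, rz⟩ := roots_of_symm h1 h2 h3
  refine ⟨![x, y, z], fin_triple_norm (root_norm_eq_one hb hab hp hl rx)
    (root_norm_eq_one hb hab hp hl ry) (root_norm_eq_one hb hab hp hl rz), h3, ?_⟩
  show x + y + z = 2 * h + x * y * z * conj (fociProd a b r h)
  rw [h1, h3]

/-- The Blaschke product that maps a vertex of a Poncelet triangle to the product of the three
vertices. -/
noncomputable def vertexProd (a b r : ℝ) (h x : ℂ) : ℂ :=
  x * (x ^ 2 - 2 * h * x + fociProd a b r h) /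
    (1 - 2 * conj h * x + conj (fociProd a b r h) * x ^ 2)

theorem vertexProd_denominator_ne_zero {h x : ℂ} (hb : 0 < b) (hab : b < a)
    (hp : IsPoristic a b r h) (hx : ‖x‖ = 1) :
    1 - 2 * conj h * x + conj (fociProd a b r h) * x ^ 2 ≠ 0 := by
  rw [conj_fociProd]
  exact chart_denominator_ne_zero hb hab hp.norm_add_lt hp.norm_sub_lt hx

theorem norm_vertexProd {h x : ℂ} (hb : 0 < b) (hab : b < a) (hp : IsPoristic a b r h)
    (hx : ‖x‖ = 1) : ‖vertexProd a b r h x‖ = 1 := by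
  have hx0 := ne_zero_of_norm_eq_one hx
  -- On the circle the denominator is x² times the conjugate of the quadratic in the numerator, so
  -- the two have equal modulus.
  have h1 : 1 - 2 * conj h * x + conj (fociProd a b r h) * x ^ 2 =
      x ^ 2 * conj (x ^ 2 - 2 * h * x + fociProd a b r h) := by
    simp only [map_add, map_sub, map_mul, map_pow, map_ofNat, conj_eq_inv hx]
    field_simp
  have h0 := vertexProd_denominator_ne_zero hb hab hp hx
  rw [vertexProd, h1, norm_div, norm_mul, norm_mul, norm_pow, RCLike.norm_conj, hx]
  rw [h1] at h0
  have h2 : ‖x ^ 2 - 2 * h * x + fociProd a b r h‖ ≠ 0 := by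
    intro h3
    apply h0
    rw [norm_eq_zero.1 h3]
    simp
  simp only [one_pow, one_mul, div_self h2]

theorem exists_triple_of_vertex {h x : ℂ} (hb : 0 < b) (hab : b < a) (hp : IsPoristic a b r h)
    (hx : ‖x‖ = 1) : ∃ z : Fin 3 → ℂ, (∀ i, ‖z i‖ = 1) ∧ z 0 = x ∧
      z 0 + z 1 + z 2 = 2 * h + z 0 * z 1 * z 2 * conj (fociProd a b r h) := by
  have hl := norm_vertexProd hb hab hp hx
  have h0 := vertexProd_denominator_ne_zero hb hab hp hx
  obtain ⟨l, hl'⟩ : ∃ l, l = vertexProd a b r h x := ⟨_, rfl⟩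
  rw [← hl'] at hl
  have heq : l * (1 - 2 * conj h * x + conj (fociProd a b r h) * x ^ 2) =
      x * (x ^ 2 - 2 * h * x + fociProd a b r h) := by
    rw [hl', vertexProd, div_mul_cancel₀ _ h0]
  obtain ⟨y, z, h1, h2, h3⟩ := exists_cubic_roots_of_root
    (A := 2 * h + l * conj (fociProd a b r h)) (B := fociProd a b r h + l * (2 * conj h))
    (l := l) (x := x) (by linear_combination -heq)
  obtain ⟨rx, ry, rz⟩ := roots_of_symm h1 h2 h3
  refine ⟨![x, y, z], fin_triple_norm (root_norm_eq_one hb hab hp hl rx)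
    (root_norm_eq_one hb hab hp hl ry) (root_norm_eq_one hb hab hp hl rz), rfl, ?_⟩
  show x + y + z = 2 * h + x * y * z * conj (fociProd a b r h)
  rw [h1, h3]

theorem chart_points_injective (hb : 0 < b) (hab : b < a) (t : Affine.Triangle ℝ Plane) :
    Function.Injective fun i => chart a b (t.points i) :=
  (chart_injective (hb.trans hab).ne' hb.ne').comp t.independent.injective

theorem isPoristic_of_nonempty (hb : 0 < b) (hab : b < a)
    (hT : (ponceletFamily a b C r).Nonempty) : IsPoristic a b r (chart a b C) := by
  obtain ⟨t, ht⟩ := hT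
  obtain ⟨h1, h2, h3⟩ := (mem_ponceletFamily_iff (hb.trans hab).ne' hb.ne').1 ht
  exact (h3.isPoristic_and_sum hb hab h2 h1 (chart_points_injective hb hab t)).1

/-- The product of the vertices of a triangle in the chart. -/
noncomputable def chartProd (a b : ℝ) (t : Affine.Triangle ℝ Plane) : ℂ :=
  ∏ i, chart a b (t.points i)

theorem chartProd_eq (t : Affine.Triangle ℝ Plane) : chartProd a b t =
    chart a b (t.points 0) * chart a b (t.points 1) * chart a b (t.points 2) := by
  rw [chartProd, Fin.prod_univ_three]

theorem norm_chartProd {t : Affine.Triangle ℝ Plane} (ht : ∀ i, ‖chart a b (t.points i)‖ = 1) :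
    ‖chartProd a b t‖ = 1 := by
  rw [chartProd_eq, norm_mul, norm_mul, ht, ht, ht]
  norm_num

/-- `covers` fixes a triangle only up to labelling; the coordinate l does not see the labels. -/
theorem chartProd_congr {t t' : Affine.Triangle ℝ Plane}
    (h : Set.range t.points = Set.range t'.points) : chartProd a b t = chartProd a b t' := by
  have key : ∀ t : Affine.Triangle ℝ Plane, chartProd a b t =
      ∏ p ∈ Finset.univ.image t.points, chart a b p := fun t => by
    rw [Finset.prod_image t.independent.injective.injOn, chartProd]
  rw [key, key]
  congr 1
  ext p
  have := Set.ext_iff.1 h p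
  simpa using this

/-- The porism as used below: given `IsPoristic`, one complex equation replaces the incircle
condition. -/
theorem mem_family_iff (hb : 0 < b) (hab : b < a) (hp : IsPoristic a b r (chart a b C))
    {t : Affine.Triangle ℝ Plane} : t ∈ ponceletFamily a b C r ↔
      (∀ i, ‖chart a b (t.points i)‖ = 1) ∧
      chart a b (t.points 0) + chart a b (t.points 1) + chart a b (t.points 2) =
        2 * chart a b C + chartProd a b t * conj (fociProd a b r (chart a b C)) := by
  rw [mem_ponceletFamily_iff (hb.trans hab).ne' hb.ne', chartProd_eq]
  refine and_congr_right fun h1 => ⟨fun h => ?_, fun h => ⟨hp.r_pos, ?_⟩⟩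
  · exact (h.2.isPoristic_and_sum hb hab h.1 h1 (chart_points_injective hb hab t)).2
  · exact (injective_and_hasIncircle hb hab hp h1 h).2

theorem exists_mem_family (hb : 0 < b) (hab : b < a) (hp : IsPoristic a b r (chart a b C))
    {z : Fin 3 → ℂ} (hz : ∀ i, ‖z i‖ = 1) (hsum : z 0 + z 1 + z 2 =
      2 * chart a b C + z 0 * z 1 * z 2 * conj (fociProd a b r (chart a b C))) :
    ∃ t ∈ ponceletFamily a b C r, ∀ i, chart a b (t.points i) = z i := by
  obtain ⟨hinj, -⟩ := injective_and_hasIncircle hb hab hp hz hsum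
  obtain ⟨t, ht⟩ := exists_triangle (hb.trans hab).ne' hb.ne'
    (crossC_ne_zero_of_norm_eq_one (hz 0) (hz 1) (hz 2)
      (hinj.ne (by decide)) (hinj.ne (by decide)) (hinj.ne (by decide)))
  refine ⟨t, (mem_family_iff hb hab hp).2 ⟨fun i => by rw [ht, hz], ?_⟩, ht⟩
  rw [chartProd_eq, ht, ht, ht, hsum]

theorem exists_mem_family_of_prod (hb : 0 < b) (hab : b < a)
    (hp : IsPoristic a b r (chart a b C)) {l : ℂ} (hl : ‖l‖ = 1) :
    ∃ t ∈ ponceletFamily a b C r, chartProd a b t = l := by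
  obtain ⟨z, h1, h2, h3⟩ := exists_triple_of_prod hb hab hp hl
  obtain ⟨t, ht, hz⟩ := exists_mem_family hb hab hp h1 h3
  exact ⟨t, ht, by rw [chartProd_eq, hz, hz, hz, h2]⟩

theorem exists_mem_family_of_vertex (hb : 0 < b) (hab : b < a)
    (hp : IsPoristic a b r (chart a b C)) {x : ℂ} (hx : ‖x‖ = 1) :
    ∃ t ∈ ponceletFamily a b C r, chart a b (t.points 0) = x := by
  obtain ⟨z, h1, h2, h3⟩ := exists_triple_of_vertex hb hab hp hx
  obtain ⟨t, ht, hz⟩ := exists_mem_family hb hab hp h1 h3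
  exact ⟨t, ht, by rw [hz, h2]⟩

theorem chart_sum_mul (hb : 0 < b) (hab : b < a) (hp : IsPoristic a b r (chart a b C))
    {t : Affine.Triangle ℝ Plane} (ht : t ∈ ponceletFamily a b C r) :
    chart a b (t.points 0) * chart a b (t.points 1) + chart a b (t.points 1) *
      chart a b (t.points 2) + chart a b (t.points 2) * chart a b (t.points 0) =
      fociProd a b r (chart a b C) + chartProd a b t * (2 * conj (chart a b C)) := by
  obtain ⟨h1, h2⟩ := (mem_family_iff hb hab hp).1 ht
  rw [chartProd_eq] at *
  exact sum_mul_eq (z := fun i => chart a b (t.points i)) h1 h2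

theorem chartProd_eq_vertexProd (hb : 0 < b) (hab : b < a) (hp : IsPoristic a b r (chart a b C))
    {t : Affine.Triangle ℝ Plane} (ht : t ∈ ponceletFamily a b C r) :
    chartProd a b t = vertexProd a b r (chart a b C) (chart a b (t.points 0)) := by
  have h3 := chart_sum_mul hb hab hp ht
  obtain ⟨h1, h2⟩ := (mem_family_iff hb hab hp).1 ht
  rw [vertexProd, eq_div_iff (vertexProd_denominator_ne_zero hb hab hp (h1 0))]
  have := (roots_of_symm h2 h3 (chartProd_eq t).symm).1
  linear_combination -this

/-- The derivative of `vertexProd` at a unimodular point does not vanish. -/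
theorem exists_hasDerivAt_vertexProd (hb : 0 < b) (hab : b < a)
    (hp : IsPoristic a b r (chart a b C)) {t : Affine.Triangle ℝ Plane}
    (ht : t ∈ ponceletFamily a b C r) : ∃ k : ℂ, k ≠ 0 ∧
      HasDerivAt (vertexProd a b r (chart a b C)) k (chart a b (t.points 0)) := by
  have h3 := chart_sum_mul hb hab hp ht
  obtain ⟨h1, h2⟩ := (mem_family_iff hb hab hp).1 ht
  have h0 := vertexProd_denominator_ne_zero hb hab hp (h1 0)
  have hl := chartProd_eq_vertexProd hb hab hp ht
  have hinj := chart_points_injective hb hab t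
  have h01 : chart a b (t.points 0) ≠ chart a b (t.points 1) :=
    hinj.ne (show (0 : Fin 3) ≠ 1 by decide)
  have h02 : chart a b (t.points 0) ≠ chart a b (t.points 2) :=
    hinj.ne (show (0 : Fin 3) ≠ 2 by decide)
  rw [vertexProd, eq_div_iff h0] at hl
  have hprod := chartProd_eq (a := a) (b := b) t
  generalize chart a b (t.points 0) = x at *
  generalize chart a b (t.points 1) = y at *
  generalize chart a b (t.points 2) = z at *
  generalize chartProd a b t = l at *
  generalize chart a b C = h at *
  have hN : HasDerivAt (fun x : ℂ => x * (x ^ 2 - 2 * h * x + fociProd a b r h))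
      (3 * x ^ 2 - 4 * h * x + fociProd a b r h) x := by
    have := (hasDerivAt_id x).mul ((((hasDerivAt_id x).pow 2).sub
      ((hasDerivAt_id x).const_mul (2 * h))).add_const (fociProd a b r h))
    convert! this using 1
    simp
    ring
  have hD : HasDerivAt (fun x : ℂ => 1 - 2 * conj h * x + conj (fociProd a b r h) * x ^ 2)
      (-2 * conj h + 2 * conj (fociProd a b r h) * x) x := by
    have := (((hasDerivAt_id x).const_mul (2 * conj h)).const_sub 1).add
      (((hasDerivAt_id x).pow 2).const_mul (conj (fociProd a b r h)))
    convert! this using 1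
    simp
    ring
  refine ⟨_, ?_, hN.div hD h0⟩
  refine div_ne_zero ?_ (pow_ne_zero 2 h0)
  -- With N = lD at x, the numerator N′D − ND′ is D times the derivative of the monic cubic N − lD
  -- with roots x, y, z.
  have hfac : (3 * x ^ 2 - 4 * h * x + fociProd a b r h) *
        (1 - 2 * conj h * x + conj (fociProd a b r h) * x ^ 2) -
      x * (x ^ 2 - 2 * h * x + fociProd a b r h) *
        (-2 * conj h + 2 * conj (fociProd a b r h) * x) =
      (1 - 2 * conj h * x + conj (fociProd a b r h) * x ^ 2) * ((x - y) * (x - z)) := by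
    linear_combination (-2 * conj h + 2 * conj (fociProd a b r h) * x) * hl +
      (1 - 2 * conj h * x + conj (fociProd a b r h) * x ^ 2) * (2 * x * h2 - h3)
  rw [hfac]
  exact mul_ne_zero h0 (mul_ne_zero (sub_ne_zero.2 h01) (sub_ne_zero.2 h02))

end Family

/-! ### The circumcircle as an affine function of l. -/

section Circumcircle

variable {a b r : ℝ} {C : Plane}

/-- On the unit circle, the equation of the image of a circle times x² is a quartic with equal
leading and constant coefficients, so its roots have product 1. Three roots are the vertices and the
fourth is conj e₃; the coefficients are the symmetric functions of these four. -/
theorem circle_equation {x y z e₁ e₂ e₃ : ℂ} (hx : ‖x‖ = 1) (hy : ‖y‖ = 1) (hz : ‖z‖ = 1)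
    (h1 : e₁ = x + y + z) (h2 : e₂ = x * y + y * z + z * x) (h3 : e₃ = x * y * z) :
    a ^ 2 * x.re ^ 2 + b ^ 2 * x.im ^ 2 -
      (a ^ 2 - b ^ 2) / 2 * (x.re * (e₁.re + e₃.re) - x.im * (e₁.im - e₃.im)) +
      ((a ^ 2 - b ^ 2) / 2 * e₂.re - (a ^ 2 + b ^ 2) / 2) = 0 := by
  have hx0 := ne_zero_of_norm_eq_one hx
  have hy0 := ne_zero_of_norm_eq_one hy
  have hz0 := ne_zero_of_norm_eq_one hz
  have hI : Complex.I ^ 2 = -1 := Complex.I_sq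
  have hI0 := Complex.I_ne_zero
  rw [← Complex.ofReal_inj, h1, h2, h3]
  push_cast
  simp only [re_cast, im_cast, map_add, map_mul, conj_eq_inv hx, conj_eq_inv hy, conj_eq_inv hz]
  field_simp
  rw [hI]
  ring

theorem affineSpan_triangle_eq_top (t : Affine.Triangle ℝ Plane) :
    affineSpan ℝ (Set.range t.points) = ⊤ := by
  rw [t.independent.affineSpan_eq_top_iff_card_eq_finrank_add_one]
  simp

theorem circumsphere_of_equation {t : Affine.Triangle ℝ Plane} {O : Plane} {k : ℝ}
    (h : ∀ i, ‖t.points i‖ ^ 2 - 2 * inner ℝ (t.points i) O + k = 0) :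
    t.circumcenter = O ∧ ∀ p, t.circumsphere.power p = ‖p‖ ^ 2 - 2 * inner ℝ p O + k := by
  have hd : ∀ i, dist (t.points i) O = √(‖O‖ ^ 2 - k) := by
    intro i
    rw [← Real.sqrt_sq dist_nonneg, dist_eq_norm, norm_sub_sq_real]
    congr 1
    linarith [h i]
  have hO : O = t.circumcenter :=
    t.eq_circumcenter_of_dist_eq (by rw [affineSpan_triangle_eq_top]; trivial) hd
  refine ⟨hO.symm, fun p => ?_⟩
  have hR : t.circumradius ^ 2 = ‖O‖ ^ 2 - k := by
    rw [← t.dist_circumcenter_eq_circumradius 0, ← hO, dist_eq_norm, norm_sub_sq_real]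
    linarith [h 0]
  rw [EuclideanGeometry.Sphere.power, t.circumsphere_center, t.circumsphere_radius, hR, ← hO,
    dist_eq_norm, norm_sub_sq_real]
  ring

/-- The circumcenter of the Poncelet triangle whose vertices have product `l` in the chart. -/
noncomputable def centerOf (a b r : ℝ) (h l : ℂ) : Plane :=
  !₂[(a ^ 2 - b ^ 2) / (4 * a) * (2 * h.re + l.re * (1 + (fociProd a b r h).re) +
      l.im * (fociProd a b r h).im),
    (a ^ 2 - b ^ 2) / (4 * b) * (-2 * h.im + l.im * (1 - (fociProd a b r h).re) +
      l.re * (fociProd a b r h).im)]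

/-- The power of the origin with respect to the circumcircle. -/
noncomputable def originPower (a b r : ℝ) (h l : ℂ) : ℝ :=
  (a ^ 2 - b ^ 2) / 2 * ((fociProd a b r h).re + 2 * (l.re * h.re + l.im * h.im)) -
    (a ^ 2 + b ^ 2) / 2

theorem circumsphere_of_mem_family (hb : 0 < b) (hab : b < a)
    (hp : IsPoristic a b r (chart a b C)) {t : Affine.Triangle ℝ Plane}
    (ht : t ∈ ponceletFamily a b C r) :
    t.circumcenter = centerOf a b r (chart a b C) (chartProd a b t) ∧
    ∀ p, t.circumsphere.power p =
      ‖p‖ ^ 2 - 2 * inner ℝ p (centerOf a b r (chart a b C) (chartProd a b t)) +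
        originPower a b r (chart a b C) (chartProd a b t) := by
  have ha : 0 < a := hb.trans hab
  have h3 := chart_sum_mul hb hab hp ht
  obtain ⟨h1, h2⟩ := (mem_family_iff hb hab hp).1 ht
  have hprod := chartProd_eq (a := a) (b := b) t
  apply circumsphere_of_equation
  have hc : ∀ i, a ^ 2 * (chart a b (t.points i)).re ^ 2 + b ^ 2 * (chart a b (t.points i)).im ^ 2 -
      (a ^ 2 - b ^ 2) / 2 * ((chart a b (t.points i)).re *
        ((2 * chart a b C + chartProd a b t * conj (fociProd a b r (chart a b C))).re +
          (chartProd a b t).re) - (chart a b (t.points i)).im *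
        ((2 * chart a b C + chartProd a b t * conj (fociProd a b r (chart a b C))).im -
          (chartProd a b t).im)) +
      ((a ^ 2 - b ^ 2) / 2 *
        (fociProd a b r (chart a b C) + chartProd a b t * (2 * conj (chart a b C))).re -
        (a ^ 2 + b ^ 2) / 2) = 0 := by
    intro i
    fin_cases i
    · exact circle_equation (h1 0) (h1 1) (h1 2) h2.symm h3.symm hprod
    · exact circle_equation (x := chart a b (t.points 1)) (y := chart a b (t.points 2))
        (z := chart a b (t.points 0)) (h1 1) (h1 2) (h1 0) (by rw [← h2]; ring) (by rw [← h3]; ring)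
        (by rw [hprod]; ring)
    · exact circle_equation (x := chart a b (t.points 2)) (y := chart a b (t.points 0))
        (z := chart a b (t.points 1)) (h1 2) (h1 0) (h1 1) (by rw [← h2]; ring) (by rw [← h3]; ring)
        (by rw [hprod]; ring)
  intro i
  rw [← hc i, plane_norm_sq, plane_inner, centerOf, originPower]
  have e0 : t.points i 0 = a * (chart a b (t.points i)).re := by simp [chart]; field_simp
  have e1 : t.points i 1 = b * (chart a b (t.points i)).im := by simp [chart]; field_simp
  rw [e0, e1]
  generalize chart a b (t.points i) = z
  generalize chart a b C = h
  generalize chartProd a b t = l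
  generalize fociProd a b r h = β
  simp
  field_simp
  ring

end Circumcircle

/-! ### Real identities for β, and the circumcenter locus. -/

section RealForm

variable {a b r : ℝ} {h : ℂ}

/-- Twice the defect `1 - |f g|²` of the foci in the chart. -/
noncomputable def defect (a b r : ℝ) (h : ℂ) : ℝ :=
  1 - (fociProd a b r h).re ^ 2 - (fociProd a b r h).im ^ 2

theorem fociProd_re : (fociProd a b r h).re = h.re ^ 2 - h.im ^ 2 + focalSq a b r := by
  simp [fociProd, sq]

theorem fociProd_im : (fociProd a b r h).im = 2 * h.re * h.im := by
  simp [fociProd, sq]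
  ring

theorem complex_norm_sq (z : ℂ) : ‖z‖ ^ 2 = z.re ^ 2 + z.im ^ 2 := by
  rw [Complex.sq_norm, Complex.normSq_apply]
  ring

theorem defect_pos (hb : 0 < b) (hab : b < a) (hp : IsPoristic a b r h) : 0 < defect a b r h := by
  have h1 := norm_fociProd_lt_one hb hab hp
  have h2 := complex_norm_sq (fociProd a b r h)
  have h3 : ‖fociProd a b r h‖ ^ 2 < 1 := by
    rw [sq_lt_one_iff₀ (norm_nonneg _)]
    exact h1
  rw [defect]
  linarith

theorem defect_eq (hp : IsPoristic a b r h) : defect a b r h =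
    2 * (1 - h.re ^ 2 - h.im ^ 2) - 2 * r ^ 2 * (1 / a ^ 2 + 1 / b ^ 2) := by
  have h1 := hp.condition
  rw [complex_norm_sq, complex_norm_sq] at h1
  rw [defect]
  linarith

/-- The closure relation evaluates 1 + |β|² and the definition evaluates Re β, so |1 − β|² reduces
to quadratic terms in h and r. -/
theorem one_sub_sq_add_sq (hp : IsPoristic a b r h) :
    (1 - (fociProd a b r h).re) ^ 2 + (fociProd a b r h).im ^ 2 =
      4 * h.im ^ 2 + 4 * r ^ 2 / a ^ 2 := by
  have h1 := hp.condition
  rw [complex_norm_sq, complex_norm_sq] at h1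
  have h2 := fociProd_re (a := a) (b := b) (r := r) (h := h)
  rw [focalSq] at h2
  linear_combination h1 - 2 * h2

theorem one_add_sq_add_sq (hp : IsPoristic a b r h) :
    (1 + (fociProd a b r h).re) ^ 2 + (fociProd a b r h).im ^ 2 =
      4 * h.re ^ 2 + 4 * r ^ 2 / b ^ 2 := by
  have h1 := hp.condition
  rw [complex_norm_sq, complex_norm_sq] at h1
  have h2 := fociProd_re (a := a) (b := b) (r := r) (h := h)
  rw [focalSq] at h2
  linear_combination h1 + 2 * h2

/-- The defect is the determinant of the matrix with rows (1 − β₁, −β₂) and (−β₂, 1 + β₁), where β =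
β₁ + iβ₂. Lagrange's identity expresses its square through the row norms and the row product, all
known. -/
theorem defect_sq (ha : a ≠ 0) (hb : b ≠ 0) (hp : IsPoristic a b r h) : defect a b r h ^ 2 =
    16 * r ^ 2 * (r ^ 2 / (a ^ 2 * b ^ 2) + h.re ^ 2 / a ^ 2 + h.im ^ 2 / b ^ 2) := by
  have h1 := one_sub_sq_add_sq hp
  have h2 := one_add_sq_add_sq hp
  have h3 := fociProd_im (a := a) (b := b) (r := r) (h := h)
  have h4 : defect a b r h ^ 2 = (4 * h.im ^ 2 + 4 * r ^ 2 / a ^ 2) *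
      (4 * h.re ^ 2 + 4 * r ^ 2 / b ^ 2) - (2 * (2 * h.re * h.im)) ^ 2 := by
    rw [← h1, ← h2, ← h3, defect]
    ring
  rw [h4]
  field_simp
  ring

/-- The axis direction of the locus of the circumcenter. -/
noncomputable def axisVector (a b : ℝ) (h : ℂ) : Plane := !₂[h.re / a, h.im / b]

theorem axisVector_norm_sq : ‖axisVector a b h‖ ^ 2 = h.re ^ 2 / a ^ 2 + h.im ^ 2 / b ^ 2 := by
  rw [plane_norm_sq]
  simp [axisVector, div_pow]

/-- In the original coordinates the axis vector is (x_c/a², y_c/b²), which places F₃ and F₃′ on one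
line through C. -/
theorem focusX_eq (ha : a ≠ 0) (hb : b ≠ 0) (C : Plane) :
    focusX a b C = C + (-b ^ 2) • axisVector a b (chart a b C) := by
  apply plane_ext <;> simp [focusX, axisVector, chart] <;> field_simp <;> ring

theorem focusY_eq (ha : a ≠ 0) (hb : b ≠ 0) (C : Plane) :
    focusY a b C = C + (-a ^ 2) • axisVector a b (chart a b C) := by
  apply plane_ext <;> simp [focusY, axisVector, chart] <;> field_simp <;> ring

theorem line_focusX_focusY (hb : 0 < b) (hab : b < a) (C : Plane) :
    line[ℝ, focusX a b C, focusY a b C] =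
      AffineSubspace.mk' C (Submodule.span ℝ {axisVector a b (chart a b C)}) := by
  have ha : 0 < a := hb.trans hab
  rw [focusX_eq ha.ne' hb.ne', focusY_eq ha.ne' hb.ne']
  exact line_add_smul_add_smul _ _ (by nlinarith)

theorem focusX_ne_focusY (hb : 0 < b) (hab : b < a) {C : Plane} (hC : C ≠ 0) :
    focusX a b C ≠ focusY a b C := by
  intro h
  have ha : 0 < a := hb.trans hab
  have h0 := congrArg (fun p : Plane => p 0) h
  have h1 := congrArg (fun p : Plane => p 1) h
  have hne : a ^ 2 - b ^ 2 ≠ 0 := by nlinarith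
  have e0 : C 0 * (a ^ 2 - b ^ 2) = 0 := by
    simp [focusX, focusY] at h0
    rcases h0 with h0 | h0
    · rw [h0, zero_mul]
    · field_simp at h0
      rw [h0, mul_zero, mul_zero]
  have e1 : C 1 * (a ^ 2 - b ^ 2) = 0 := by
    simp [focusX, focusY] at h1
    rcases h1 with h1 | h1
    · rw [h1, zero_mul]
    · field_simp at h1
      rw [← neg_sub, h1, mul_zero, neg_zero, mul_zero]
  exact hC (plane_ext ((mul_eq_zero.1 e0).resolve_right hne)
    ((mul_eq_zero.1 e1).resolve_right hne))

/-- The locus of the circumcenter is an ellipse. -/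
theorem circumcenterLocus_isEllipse (hb : 0 < b) (hab : b < a) {C : Plane}
    (hp : IsPoristic a b r (chart a b C)) :
    IsEllipseWithFoci (circumcenterLocus a b C r) (focusX a b C) (focusY a b C) := by
  have ha : 0 < a := hb.trans hab
  have hr := hp.r_pos
  have hE := defect_pos hb hab hp
  have hc : 0 < a ^ 2 - b ^ 2 := by nlinarith
  have hX : focusX a b C = (C + (-(a ^ 2 + b ^ 2) / 2) • axisVector a b (chart a b C)) +
      ((a ^ 2 - b ^ 2) / 2) • axisVector a b (chart a b C) := by
    rw [focusX_eq ha.ne' hb.ne']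
    module
  have hY : focusY a b C = (C + (-(a ^ 2 + b ^ 2) / 2) • axisVector a b (chart a b C)) -
      ((a ^ 2 - b ^ 2) / 2) • axisVector a b (chart a b C) := by
    rw [focusY_eq ha.ne' hb.ne']
    module
  rw [hX, hY]
  have hf2 : ‖((a ^ 2 - b ^ 2) / 2) • axisVector a b (chart a b C)‖ ^ 2 = (a ^ 2 - b ^ 2) ^ 2 / 4 *
      ((chart a b C).re ^ 2 / a ^ 2 + (chart a b C).im ^ 2 / b ^ 2) := by
    rw [norm_smul, mul_pow, axisVector_norm_sq, Real.norm_eq_abs, sq_abs]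
    ring
  have hE2 := defect_sq ha.ne' hb.ne' hp
  have hs2 : ((a ^ 2 - b ^ 2) * defect a b r (chart a b C) / (8 * r)) ^ 2 = (a ^ 2 - b ^ 2) ^ 2 / 4 *
      (r ^ 2 / (a ^ 2 * b ^ 2) + (chart a b C).re ^ 2 / a ^ 2 + (chart a b C).im ^ 2 / b ^ 2) := by
    rw [div_pow, mul_pow, hE2]
    field_simp
    ring
  refine isEllipseWithFoci_of_quadratic
    (s := (a ^ 2 - b ^ 2) * defect a b r (chart a b C) / (8 * r)) ?_ fun P => ?_
  · refine lt_of_pow_lt_pow_left₀ 2 (by positivity) ?_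
    rw [hf2, hs2]
    have : 0 < (a ^ 2 - b ^ 2) ^ 2 / 4 * (r ^ 2 / (a ^ 2 * b ^ 2)) := by positivity
    linarith
  · have hmem : P ∈ circumcenterLocus a b C r ↔
        ∃ l : ℂ, ‖l‖ = 1 ∧ centerOf a b r (chart a b C) l = P := by
      constructor
      · rintro ⟨t, ht, rfl⟩
        exact ⟨chartProd a b t, norm_chartProd ((mem_family_iff hb hab hp).1 ht).1,
          (circumsphere_of_mem_family hb hab hp ht).1.symm⟩
      · rintro ⟨l, hl, rfl⟩
        obtain ⟨t, ht, rfl⟩ := exists_mem_family_of_prod hb hab hp hl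
        exact ⟨t, ht, (circumsphere_of_mem_family hb hab hp ht).1⟩
    rw [hmem]
    have F1 := one_sub_sq_add_sq hp
    have F2 := one_add_sq_add_sq hp
    have F3 := fociProd_im (a := a) (b := b) (r := r) (h := chart a b C)
    have hC0 : C 0 = a * (chart a b C).re := by simp [chart]; field_simp
    have hC1 : C 1 = b * (chart a b C).im := by simp [chart]; field_simp
    have hEdef : defect a b r (chart a b C) = 1 - (fociProd a b r (chart a b C)).re ^ 2 -
      (fociProd a b r (chart a b C)).im ^ 2 := rfl
    rw [hs2, hf2, inner_smul_left, plane_inner, plane_norm_sq]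
    simp only [PiLp.sub_apply, PiLp.add_apply, PiLp.smul_apply, conj_trivial, smul_eq_mul, hC0, hC1]
    have v0 : axisVector a b (chart a b C) 0 = (chart a b C).re / a := rfl
    have v1 : axisVector a b (chart a b C) 1 = (chart a b C).im / b := rfl
    rw [v0, v1]
    -- In these coordinates the circumcenter is (ξ, η) = Ql with Q symmetric of determinant
    -- `defect`; Cramer's rule turns |l| = 1 into one quadratic equation.
    set ξ := 4 * a / (a ^ 2 - b ^ 2) * P 0 - 2 * (chart a b C).re with hξ
    set η := 4 * b / (a ^ 2 - b ^ 2) * P 1 + 2 * (chart a b C).im with hη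
    have hP0 : P 0 = (a ^ 2 - b ^ 2) / (4 * a) * (ξ + 2 * (chart a b C).re) := by
      rw [hξ]; field_simp; ring
    have hP1 : P 1 = (a ^ 2 - b ^ 2) / (4 * b) * (η - 2 * (chart a b C).im) := by
      rw [hη]; field_simp; ring
    have hleft : (∃ l : ℂ, ‖l‖ = 1 ∧ centerOf a b r (chart a b C) l = P) ↔
        ((1 - (fociProd a b r (chart a b C)).re) * ξ - (fociProd a b r (chart a b C)).im * η) ^ 2 +
        (-(fociProd a b r (chart a b C)).im * ξ + (1 + (fociProd a b r (chart a b C)).re) * η) ^ 2 =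
          defect a b r (chart a b C) ^ 2 := by
      constructor
      · rintro ⟨l, hl, hlP⟩
        rw [norm_eq_one_iff_sq] at hl
        have e0 := congrArg (fun p : Plane => p 0) hlP
        have e1 := congrArg (fun p : Plane => p 1) hlP
        simp [centerOf] at e0 e1
        rw [hP0] at e0
        rw [hP1] at e1
        have e0' := mul_left_cancel₀ (by positivity) e0
        have e1' := mul_left_cancel₀ (by positivity) e1
        have x0 : ξ = l.re * (1 + (fociProd a b r (chart a b C)).re) +
          l.im * (fociProd a b r (chart a b C)).im := by linarith
        have x1 : η = l.im * (1 - (fociProd a b r (chart a b C)).re) +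
          l.re * (fociProd a b r (chart a b C)).im := by linarith
        rw [x0, x1, hEdef]
        linear_combination (1 - (fociProd a b r (chart a b C)).re ^ 2 -
          (fociProd a b r (chart a b C)).im ^ 2) ^ 2 * hl
      · intro hq
        refine ⟨⟨((1 - (fociProd a b r (chart a b C)).re) * ξ -
          (fociProd a b r (chart a b C)).im * η) / defect a b r (chart a b C),
          (-(fociProd a b r (chart a b C)).im * ξ + (1 + (fociProd a b r (chart a b C)).re) * η) /
          defect a b r (chart a b C)⟩, ?_, ?_⟩
        · rw [norm_eq_one_iff_sq]
          simp only [div_pow]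
          rw [← add_div, hq, div_self (by positivity)]
        · apply plane_ext
          · rw [hP0]
            simp only [centerOf]
            simp
            left
            field_simp
            rw [hEdef]
            ring
          · rw [hP1]
            simp only [centerOf]
            simp
            left
            field_simp
            rw [hEdef]
            ring
    rw [hleft, hE2, hP0, hP1]
    generalize (fociProd a b r (chart a b C)).re = β₁ at *
    generalize (fociProd a b r (chart a b C)).im = β₂ at *
    have hform : ((1 - β₁) * ξ - β₂ * η) ^ 2 + (-β₂ * ξ + (1 + β₁) * η) ^ 2 =
        (4 * (chart a b C).im ^ 2 + 4 * r ^ 2 / a ^ 2) * ξ ^ 2 -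
          4 * (2 * (chart a b C).re * (chart a b C).im) * ξ * η +
          (4 * (chart a b C).re ^ 2 + 4 * r ^ 2 / b ^ 2) * η ^ 2 := by
      rw [← F1, ← F2, ← F3]
      ring
    rw [hform]
    clear_value ξ η
    generalize (chart a b C).re = p at *
    generalize (chart a b C).im = q at *
    rw [← sub_eq_zero, ← sub_eq_zero (a := _ - _ ^ 2)]
    -- The constant ratio between the focal equation of the locus and the quadratic equation in ξ,
    -- η.
    have hκ : (a ^ 2 - b ^ 2) ^ 4 / (256 * a ^ 2 * b ^ 2) ≠ 0 := by positivity
    rw [← mul_right_inj' hκ, mul_zero]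
    refine Eq.congr ?_ rfl
    field_simp
    ring

end RealForm

/-! ### The radical function and its envelope. -/

section Envelope

variable {a b r : ℝ} {C : Plane} {T : ℝ → Affine.Triangle ℝ Plane}

theorem hasDerivAt_chart {f : ℝ → Plane} {v : Plane} {u : ℝ} (hf : HasDerivAt f v u) :
    HasDerivAt (fun s => chart a b (f s)) (chart a b v) u := by
  have h : ∀ i : Fin 2, HasDerivAt (fun s => f s i) (v i) u := fun i =>
    (EuclideanSpace.proj (𝕜 := ℝ) i).hasFDerivAt.comp_hasDerivAt u hf
  have h0 := ((h 0).div_const a).ofReal_comp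
  have h1 := (((h 1).div_const b).ofReal_comp).mul_const Complex.I
  have heq : ∀ p : Plane, chart a b p = ((p 0 / a : ℝ) : ℂ) + ((p 1 / b : ℝ) : ℂ) * Complex.I := by
    intro p
    apply Complex.ext <;> simp [chart]
  simp only [heq]
  exact h0.add h1

/-- Along a regular parametrization, the product of the vertices moves regularly. -/
theorem exists_hasDerivAt_chartProd (hb : 0 < b) (hab : b < a)
    (hp : IsPoristic a b r (chart a b C)) (hT : IsRegularParametrization a b C r T) (u : ℝ) :
    ∃ θ : ℝ, θ ≠ 0 ∧ HasDerivAt (fun s => (chartProd a b (T s)).re)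
        (-θ * (chartProd a b (T u)).im) u ∧
      HasDerivAt (fun s => (chartProd a b (T s)).im) (θ * (chartProd a b (T u)).re) u := by
  obtain ⟨v, hv, hd⟩ := hT.regular u
  obtain ⟨k, hk, hkd⟩ := exists_hasDerivAt_vertexProd hb hab hp (hT.mem u)
  have hcomp := hkd.comp u (hasDerivAt_chart (a := a) (b := b) hd)
  have hfun : (vertexProd a b r (chart a b C) ∘ fun s => chart a b ((T s).points 0)) =
      fun s => chartProd a b (T s) := by
    funext s
    exact (chartProd_eq_vertexProd hb hab hp (hT.mem s)).symm
  rw [hfun] at hcomp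
  have hne : k * chart a b v ≠ 0 := by
    refine mul_ne_zero hk fun h0 => hv ?_
    apply chart_injective (hb.trans hab).ne' hb.ne'
    rw [h0]
    apply Complex.ext <;> simp [chart]
  generalize k * chart a b v = μ at *
  have hre : HasDerivAt (fun s => (chartProd a b (T s)).re) μ.re u :=
    Complex.reCLM.hasFDerivAt.comp_hasDerivAt u hcomp
  have him : HasDerivAt (fun s => (chartProd a b (T s)).im) μ.im u :=
    Complex.imCLM.hasFDerivAt.comp_hasDerivAt u hcomp
  have hnorm : ∀ s, (chartProd a b (T s)).re ^ 2 + (chartProd a b (T s)).im ^ 2 = 1 := fun s =>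
    norm_eq_one_iff_sq.1 (norm_chartProd ((mem_family_iff hb hab hp).1 (hT.mem s)).1)
  have hsum := (hre.pow 2).add (him.pow 2)
  have hconst : HasDerivAt ((fun s => (chartProd a b (T s)).re) ^ 2 +
      (fun s => (chartProd a b (T s)).im) ^ 2) 0 u := by
    have : (fun s => (chartProd a b (T s)).re) ^ 2 + (fun s => (chartProd a b (T s)).im) ^ 2 =
        fun _ => (1 : ℝ) := by
      funext s
      exact hnorm s
    rw [this]
    exact hasDerivAt_const u 1
  have h0 := hsum.unique hconst
  simp only [Nat.cast_ofNat, Nat.add_one_sub_one, pow_one] at h0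
  have hu := hnorm u
  generalize chartProd a b (T u) = l at *
  have h0' : l.re * μ.re + l.im * μ.im = 0 := by linarith
  -- Because |l| is constant, the velocity μ is perpendicular to l, hence μ = iθl with θ = Im(l̄μ).
  refine ⟨l.re * μ.im - l.im * μ.re, fun hθ => hne ?_, ?_, ?_⟩
  · apply Complex.ext
    · simp only [Complex.zero_re]
      linear_combination (-μ.re) * hu + l.re * h0' - l.im * hθ
    · simp only [Complex.zero_im]
      linear_combination (-μ.im) * hu + l.im * h0' + l.re * hθ
  · convert! hre using 1
    linear_combination μ.re * hu - l.re * h0'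
  · convert! him using 1
    linear_combination μ.im * hu - l.im * h0'

/-- The point of the plane whose radical function is constant along the Poncelet family. -/
noncomputable def polarCenter (a b r : ℝ) (C : Plane) : Plane :=
  C + (4 * r ^ 2 / defect a b r (chart a b C)) • axisVector a b (chart a b C)

/-- The value of the radical function at `polarCenter`. -/
noncomputable def polarValue (a b r : ℝ) (C : Plane) : ℝ :=
  r ^ 2 * (1 + 4 * r ^ 2 * (1 / a ^ 2 + 1 / b ^ 2) / defect a b r (chart a b C))

/-- The two terms ‖P‖² cancel, and the circumcircle is affine in l, so the radical function is
affine in P and in (Re l, Im l). Taking `polarCenter` as origin removes the constant terms from the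
coefficients of Re l and Im l. -/
theorem radicalFunction_eq (hb : 0 < b) (hab : b < a)
    (hp : IsPoristic a b r (chart a b C)) {t : Affine.Triangle ℝ Plane}
    (ht : t ∈ ponceletFamily a b C r) (P : Plane) :
    radicalFunction t P = (polarValue a b r C - (a ^ 2 + b ^ 2) *
        inner ℝ (axisVector a b (chart a b C)) (P - polarCenter a b r C)) +
      (chartProd a b t).re * ((a ^ 2 - b ^ 2) / 2 * ((P - polarCenter a b r C) 0 / a *
        (1 + (fociProd a b r (chart a b C)).re) +
        (P - polarCenter a b r C) 1 / b * (fociProd a b r (chart a b C)).im)) +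
      (chartProd a b t).im * ((a ^ 2 - b ^ 2) / 2 * ((P - polarCenter a b r C) 0 / a *
        (fociProd a b r (chart a b C)).im +
        (P - polarCenter a b r C) 1 / b * (1 - (fociProd a b r (chart a b C)).re))) := by
  have ha : 0 < a := hb.trans hab
  have hE := defect_pos hb hab hp
  have hins : t.insphere = ⟨C, r⟩ := ht.2
  rw [radicalFunction, (circumsphere_of_mem_family hb hab hp ht).2, hins,
    EuclideanGeometry.Sphere.power, plane_dist_sq, plane_norm_sq, plane_inner, plane_inner,
    centerOf, originPower, polarCenter, polarValue]
  have hC0 : C 0 = a * (chart a b C).re := by simp [chart]; field_simp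
  have hC1 : C 1 = b * (chart a b C).im := by simp [chart]; field_simp
  have v0 : axisVector a b (chart a b C) 0 = (chart a b C).re / a := rfl
  have v1 : axisVector a b (chart a b C) 1 = (chart a b C).im / b := rfl
  simp only [PiLp.sub_apply, PiLp.add_apply, PiLp.smul_apply, smul_eq_mul, hC0, hC1, v0, v1]
  have hE2 := defect_sq ha.ne' hb.ne' hp
  have hE1 := defect_eq hp
  have hβ1 := fociProd_re (a := a) (b := b) (r := r) (h := chart a b C)
  have hβ2 := fociProd_im (a := a) (b := b) (r := r) (h := chart a b C)
  rw [focalSq] at hβ1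
  generalize chartProd a b t = l at *
  generalize (fociProd a b r (chart a b C)).re = β₁ at *
  generalize (fociProd a b r (chart a b C)).im = β₂ at *
  generalize defect a b r (chart a b C) = E at *
  generalize (chart a b C).re = p at *
  generalize (chart a b C).im = q at *
  generalize P 0 = x
  generalize P 1 = y
  obtain ⟨τ, hτ⟩ : ∃ τ, τ = 4 * r ^ 2 / E := ⟨_, rfl⟩
  have hval : r ^ 2 * (1 + 4 * r ^ 2 * (1 / a ^ 2 + 1 / b ^ 2) / E) =
      r ^ 2 * (1 + τ * (1 / a ^ 2 + 1 / b ^ 2)) := by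
    rw [hτ]
    ring
  rw [← hτ, hval]
  have hτE : τ * E = 4 * r ^ 2 := by rw [hτ, div_mul_cancel₀ _ hE.ne']
  have hE2' : E ^ 2 = 16 * r ^ 2 * (r ^ 2 * (1 / a ^ 2) * (1 / b ^ 2) + p ^ 2 * (1 / a ^ 2) +
      q ^ 2 * (1 / b ^ 2)) := by
    rw [hE2]
    field_simp
  obtain ⟨A, hA⟩ : ∃ A, A = 1 / a ^ 2 := ⟨_, rfl⟩
  obtain ⟨B, hB⟩ : ∃ B, B = 1 / b ^ 2 := ⟨_, rfl⟩
  have hA' : a ^ 2 * A = 1 := by rw [hA]; field_simp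
  have hB' : b ^ 2 * B = 1 := by rw [hB]; field_simp
  rw [← hA, ← hB] at hE1 hE2' hβ1 ⊢
  -- `H1` and `H2` say that the coefficients of Re l and Im l vanish at `polarCenter`; `H0` below
  -- evaluates the remaining constant.
  have H1 : p * (1 + τ * A) * (1 + β₁) + q * (1 + τ * B) * β₂ = 2 * p := by
    apply mul_left_cancel₀ hE.ne'
    rw [hβ1, hβ2]
    linear_combination (p * A * (1 + (p ^ 2 - q ^ 2 + r ^ 2 * (B - A))) +
      q * B * (2 * p * q)) * hτE + p * (E / 2 - 2 * r ^ 2 * A) * hE1 - p / 2 * hE2'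
  have H2 : p * (1 + τ * A) * β₂ + q * (1 + τ * B) * (1 - β₁) = 2 * q := by
    apply mul_left_cancel₀ hE.ne'
    rw [hβ1, hβ2]
    linear_combination (q * B * (1 - (p ^ 2 - q ^ 2 + r ^ 2 * (B - A))) +
      p * A * (2 * p * q)) * hτE + q * (E / 2 - 2 * r ^ 2 * B) * hE1 - q / 2 * hE2'
  have HS : τ * (r ^ 2 * A * B + p ^ 2 * A + q ^ 2 * B) = E / 4 := by
    apply mul_left_cancel₀ hE.ne'
    linear_combination (r ^ 2 * A * B + p ^ 2 * A + q ^ 2 * B) * hτE - hE2' / 4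
  have H0 : a ^ 2 * p ^ 2 + b ^ 2 * q ^ 2 - 2 * r ^ 2 - (a ^ 2 - b ^ 2) / 2 * β₁ +
      (a ^ 2 + b ^ 2) / 2 - (a ^ 2 + b ^ 2) * (p ^ 2 + q ^ 2) =
      τ * (r ^ 2 * (A + B) + (a ^ 2 + b ^ 2) * (p ^ 2 * A + q ^ 2 * B)) := by
    have h1 : A + B = (a ^ 2 + b ^ 2) * (A * B) := by
      linear_combination (-B) * hA' - A * hB'
    rw [h1, hβ1]
    linear_combination (-(a ^ 2 + b ^ 2)) * HS - (a ^ 2 + b ^ 2) / 4 * hE1 + r ^ 2 * hA' +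
      r ^ 2 * hB'
  simp only [Matrix.cons_val_zero, Matrix.cons_val_one]
  rw [hA, hB] at H0 H1 H2 ⊢
  clear hA hB hA' hB' hE1 hE2 hE2' HS hβ1 hβ2 hval hτ hτE hC0 hC1 v0 v1
  linear_combination (norm := skip) H0 + l.re * ((a ^ 2 - b ^ 2) / 2) * H1 +
    l.im * ((a ^ 2 - b ^ 2) / 2) * H2
  field_simp
  ring

/-- F = A + B · l is stationary exactly when the vector B = (B₁, B₂) is parallel to l; together with
F = 0 this forces A² = |B|². Conversely l = −B/A is unimodular and attained by the family. -/
theorem mem_envelope_iff (hb : 0 < b) (hab : b < a)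
    (hp : IsPoristic a b r (chart a b C)) (hT : IsRegularParametrization a b C r T) (P : Plane) :
    P ∈ envelope (fun u => radicalFunction (T u)) ↔
      (a ^ 2 - b ^ 2) ^ 2 * r ^ 2 / (a ^ 2 * b ^ 2) * ‖P - polarCenter a b r C‖ ^ 2 =
        polarValue a b r C ^ 2 - 2 * (a ^ 2 + b ^ 2) * polarValue a b r C *
          inner ℝ (axisVector a b (chart a b C)) (P - polarCenter a b r C) +
        4 * a ^ 2 * b ^ 2 *
          inner ℝ (axisVector a b (chart a b C)) (P - polarCenter a b r C) ^ 2 := by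
  have ha : 0 < a := hb.trans hab
  have hF := fun u => radicalFunction_eq hb hab hp (hT.mem u) P
  have F1 := one_sub_sq_add_sq hp
  have F2 := one_add_sq_add_sq hp
  have hβ2 := fociProd_im (a := a) (b := b) (r := r) (h := chart a b C)
  obtain ⟨A, hA⟩ : ∃ A, A = polarValue a b r C - (a ^ 2 + b ^ 2) *
    inner ℝ (axisVector a b (chart a b C)) (P - polarCenter a b r C) := ⟨_, rfl⟩
  obtain ⟨B₁, hB₁⟩ : ∃ B₁, B₁ = (a ^ 2 - b ^ 2) / 2 * ((P - polarCenter a b r C) 0 / a *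
        (1 + (fociProd a b r (chart a b C)).re) +
        (P - polarCenter a b r C) 1 / b * (fociProd a b r (chart a b C)).im) := ⟨_, rfl⟩
  obtain ⟨B₂, hB₂⟩ : ∃ B₂, B₂ = (a ^ 2 - b ^ 2) / 2 * ((P - polarCenter a b r C) 0 / a *
        (fociProd a b r (chart a b C)).im +
        (P - polarCenter a b r C) 1 / b * (1 - (fociProd a b r (chart a b C)).re)) := ⟨_, rfl⟩
  simp only [← hA, ← hB₁, ← hB₂] at hF
  -- The porism identities collapse this form to a multiple of ‖y‖² plus a multiple of ⟨v, y⟩².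
  -- Subtracting it from A² leaves the coefficient (a² + b²)² − (a² − b²)² = 4a²b².
  have hquad : B₁ ^ 2 + B₂ ^ 2 = (a ^ 2 - b ^ 2) ^ 2 *
      (r ^ 2 / (a ^ 2 * b ^ 2) * ‖P - polarCenter a b r C‖ ^ 2 +
        inner ℝ (axisVector a b (chart a b C)) (P - polarCenter a b r C) ^ 2) := by
    have v0 : axisVector a b (chart a b C) 0 = (chart a b C).re / a := rfl
    have v1 : axisVector a b (chart a b C) 1 = (chart a b C).im / b := rfl
    rw [hB₁, hB₂, plane_inner, plane_norm_sq, v0, v1]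
    generalize (P - polarCenter a b r C) 0 = y₀
    generalize (P - polarCenter a b r C) 1 = y₁
    have : ∀ β₁ β₂ : ℝ, ((a ^ 2 - b ^ 2) / 2 * (y₀ / a * (1 + β₁) + y₁ / b * β₂)) ^ 2 +
        ((a ^ 2 - b ^ 2) / 2 * (y₀ / a * β₂ + y₁ / b * (1 - β₁))) ^ 2 =
        (a ^ 2 - b ^ 2) ^ 2 / 4 * (((1 + β₁) ^ 2 + β₂ ^ 2) * (y₀ / a) ^ 2 +
          ((1 - β₁) ^ 2 + β₂ ^ 2) * (y₁ / b) ^ 2 + 4 * β₂ * (y₀ / a) * (y₁ / b)) := by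
      intro β₁ β₂
      ring
    rw [this, F1, F2, hβ2]
    field_simp
    ring
  have hgoal : A ^ 2 = B₁ ^ 2 + B₂ ^ 2 ↔
      (a ^ 2 - b ^ 2) ^ 2 * r ^ 2 / (a ^ 2 * b ^ 2) * ‖P - polarCenter a b r C‖ ^ 2 =
        polarValue a b r C ^ 2 - 2 * (a ^ 2 + b ^ 2) * polarValue a b r C *
          inner ℝ (axisVector a b (chart a b C)) (P - polarCenter a b r C) +
        4 * a ^ 2 * b ^ 2 *
          inner ℝ (axisVector a b (chart a b C)) (P - polarCenter a b r C) ^ 2 := by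
    rw [hquad, hA]
    constructor <;> intro h <;> linear_combination -h
  rw [← hgoal]
  have hnorm : ∀ s, (chartProd a b (T s)).re ^ 2 + (chartProd a b (T s)).im ^ 2 = 1 := fun s =>
    norm_eq_one_iff_sq.1 (norm_chartProd ((mem_family_iff hb hab hp).1 (hT.mem s)).1)
  have hder : ∀ u, HasDerivAt (fun s => radicalFunction (T s) P) 0 u ↔
      (chartProd a b (T u)).re * B₂ = (chartProd a b (T u)).im * B₁ := by
    intro u
    obtain ⟨θ, hθ, hre, him⟩ := exists_hasDerivAt_chartProd hb hab hp hT u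
    have hd := ((hre.mul_const B₁).const_add A).add (him.mul_const B₂)
    have hfun : (fun s => radicalFunction (T s) P) =
        (fun s => A + (chartProd a b (T s)).re * B₁) + fun s => (chartProd a b (T s)).im * B₂ :=
      funext hF
    rw [hfun]
    constructor
    · intro h0
      have := hd.unique h0
      apply mul_left_cancel₀ hθ
      linear_combination this
    · intro h0
      convert! hd using 1
      linear_combination (-θ) * h0
  constructor
  · rintro ⟨u, hu0, hu1⟩
    have h1 := (hder u).1 hu1
    have h2 : A + (chartProd a b (T u)).re * B₁ + (chartProd a b (T u)).im * B₂ = 0 := by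
      rw [← hF u]
      exact hu0
    have h3 := hnorm u
    generalize chartProd a b (T u) = l at *
    linear_combination (A - l.re * B₁ - l.im * B₂) * h2 - (l.re * B₂ - l.im * B₁) * h1 +
      (B₁ ^ 2 + B₂ ^ 2) * h3
  · intro h
    -- If A = 0 then B = 0, the radical function vanishes identically in u, and any parameter
    -- serves.
    by_cases hA0 : A = 0
    · have h1 : B₁ = 0 := by nlinarith [sq_nonneg B₁, sq_nonneg B₂]
      have h2 : B₂ = 0 := by nlinarith [sq_nonneg B₁, sq_nonneg B₂]
      refine ⟨0, ?_, (hder 0).2 (by rw [h1, h2, mul_zero, mul_zero])⟩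
      show radicalFunction (T 0) P = 0
      rw [hF, hA0, h1, h2]
      ring
    · have hl : ‖(⟨-B₁ / A, -B₂ / A⟩ : ℂ)‖ = 1 := by
        rw [norm_eq_one_iff_sq]
        field_simp
        linarith
      obtain ⟨t, ht, htl⟩ := exists_mem_family_of_prod hb hab hp hl
      obtain ⟨u, hu⟩ := hT.covers t ht
      have hlu : chartProd a b (T u) = ⟨-B₁ / A, -B₂ / A⟩ := by
        rw [← htl, chartProd_congr hu]
      refine ⟨u, ?_, (hder u).2 ?_⟩
      · show radicalFunction (T u) P = 0
        rw [hF, hlu]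
        field_simp
        linarith
      · rw [hlu]
        field_simp

/-- Let the first vertex have eccentric angle u and choose the others arbitrarily; their continuity
is not required. -/
theorem exists_regularParametrization (hb : 0 < b) (hab : b < a)
    (hp : IsPoristic a b r (chart a b C)) : ∃ T, IsRegularParametrization a b C r T := by
  have ha : 0 < a := hb.trans hab
  have hex : ∀ u : ℝ, ∃ t ∈ ponceletFamily a b C r,
      chart a b (t.points 0) = Complex.exp (u * Complex.I) := fun u =>
    exists_mem_family_of_vertex hb hab hp (Complex.norm_exp_ofReal_mul_I u)
  choose T hT hT0 using hex
  have hpt : ∀ u, (T u).points 0 = !₂[a * Real.cos u, b * Real.sin u] := by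
    intro u
    rw [← unchart_chart ha.ne' hb.ne' ((T u).points 0), hT0, unchart,
      Complex.exp_ofReal_mul_I_re, Complex.exp_ofReal_mul_I_im]
  refine ⟨T, hT, fun u => ⟨!₂[a * -Real.sin u, b * Real.cos u], ?_, ?_⟩, fun t ht => ?_⟩
  · intro h0
    have h1 : a * -Real.sin u = 0 := congrArg (fun p : Plane => p 0) h0
    have h2 : b * Real.cos u = 0 := congrArg (fun p : Plane => p 1) h0
    have h3 : Real.sin u = 0 := neg_eq_zero.1 ((mul_eq_zero.1 h1).resolve_left ha.ne')
    have h4 : Real.cos u = 0 := (mul_eq_zero.1 h2).resolve_left hb.ne'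
    have := Real.sin_sq_add_cos_sq u
    rw [h3, h4] at this
    norm_num at this
  · have hfun : (fun s => (T s).points 0) = fun s => !₂[a * Real.cos s, b * Real.sin s] :=
      funext hpt
    rw [hfun]
    refine (EuclideanSpace.equiv (Fin 2) ℝ).symm.toContinuousLinearMap.hasFDerivAt.comp_hasDerivAt
      (f := fun s => ![a * Real.cos s, b * Real.sin s]) u (hasDerivAt_pi.2 fun i => ?_)
    fin_cases i
    · exact (Real.hasDerivAt_cos u).const_mul a
    · exact (Real.hasDerivAt_sin u).const_mul b
  · have hx : ‖chart a b (t.points 0)‖ = 1 := ((mem_family_iff hb hab hp).1 ht).1 0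
    refine ⟨(chart a b (t.points 0)).arg, ?_⟩
    set u := (chart a b (t.points 0)).arg with hu
    have h0 : chart a b ((T u).points 0) = chart a b (t.points 0) := by
      rw [hT0, hu]
      conv_rhs => rw [← Complex.norm_mul_exp_arg_mul_I (chart a b (t.points 0)), hx]
      simp
    have hprod : chartProd a b (T u) = chartProd a b t := by
      rw [chartProd_eq_vertexProd hb hab hp (hT u), chartProd_eq_vertexProd hb hab hp ht, h0]
    -- Equal products give the same cubic, hence the same vertex set.
    have key : ∀ t₁ ∈ ponceletFamily a b C r, ∀ t₂ ∈ ponceletFamily a b C r,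
        chartProd a b t₁ = chartProd a b t₂ → Set.range t₁.points ⊆ Set.range t₂.points := by
      rintro t₁ h₁ t₂ h₂ h₁₂ _ ⟨i, rfl⟩
      have s1 := ((mem_family_iff hb hab hp).1 h₁).2
      have s2 := ((mem_family_iff hb hab hp).1 h₂).2
      have m1 := chart_sum_mul hb hab hp h₁
      have m2 := chart_sum_mul hb hab hp h₂
      rw [h₁₂, ← s2] at s1
      rw [h₁₂, ← m2] at m1
      have r1 := roots_of_symm s1 m1 ((chartProd_eq t₁).symm.trans (h₁₂.trans (chartProd_eq t₂)))
      have hall : ∀ i, chart a b (t₁.points i) ^ 3 -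
          (chart a b (t₂.points 0) + chart a b (t₂.points 1) + chart a b (t₂.points 2)) *
            chart a b (t₁.points i) ^ 2 +
          (chart a b (t₂.points 0) * chart a b (t₂.points 1) + chart a b (t₂.points 1) *
            chart a b (t₂.points 2) + chart a b (t₂.points 2) * chart a b (t₂.points 0)) *
            chart a b (t₁.points i) -
          chart a b (t₂.points 0) * chart a b (t₂.points 1) * chart a b (t₂.points 2) = 0 := by
        intro i
        fin_cases i
        exacts [r1.1, r1.2.1, r1.2.2]
      have hroot : (chart a b (t₁.points i) - chart a b (t₂.points 0)) *
          ((chart a b (t₁.points i) - chart a b (t₂.points 1)) *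
          (chart a b (t₁.points i) - chart a b (t₂.points 2))) = 0 := by
        linear_combination hall i
      have hinj := chart_injective (a := a) (b := b) ha.ne' hb.ne'
      rcases mul_eq_zero.1 hroot with h | h
      · exact ⟨0, (hinj (sub_eq_zero.1 h)).symm⟩
      · rcases mul_eq_zero.1 h with h | h
        · exact ⟨1, (hinj (sub_eq_zero.1 h)).symm⟩
        · exact ⟨2, (hinj (sub_eq_zero.1 h)).symm⟩
    exact (key t ht _ (hT u) hprod.symm).antisymm (key _ (hT u) t ht hprod)

end Envelope

/-! ### Centroids of inscribed equilateral triangles. -/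

section Equilateral

variable {a b : ℝ}

theorem centroid_apply (t : Affine.Triangle ℝ Plane) (j : Fin 2) :
    t.centroid j = (t.points 0 j + t.points 1 j + t.points 2 j) / 3 := by
  have h := congrArg (fun p : Plane => p j) (t.centroid_vsub_eq (0 : Plane))
  have hs : ∑ i, t.points i = t.points 0 + t.points 1 + t.points 2 := Fin.sum_univ_three _
  simp only [vsub_eq_sub, sub_zero, PiLp.smul_apply, hs, PiLp.add_apply, smul_eq_mul] at h
  rw [h]
  push_cast
  ring

theorem mem_centroid_ellipse_iff (hb : 0 < b) (hab : b < a) (p : Plane) :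
    p ∈ axisEllipse (a * (a ^ 2 - b ^ 2) / (a ^ 2 + 3 * b ^ 2))
        (b * (a ^ 2 - b ^ 2) / (3 * a ^ 2 + b ^ 2)) ↔
      p 0 ^ 2 / a ^ 2 + p 1 ^ 2 / b ^ 2 + (1 / a ^ 2 + 1 / b ^ 2) / 2 *
        ((4 * b ^ 2 * p 0 / (a ^ 2 - b ^ 2)) ^ 2 + (4 * a ^ 2 * p 1 / (a ^ 2 - b ^ 2)) ^ 2) = 1 := by
  have ha : 0 < a := hb.trans hab
  have hc : 0 < a ^ 2 - b ^ 2 := by nlinarith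
  rw [axisEllipse, Set.mem_ofPred_eq]
  refine Eq.congr ?_ rfl
  field_simp
  ring

/-- Both x² + y² and x² − y² are replaced by affine expressions, so the ellipse equation becomes
affine in the offset (x, y) from the centroid. -/
theorem ellipse_expansion (hb : 0 < b) (hab : b < a) {g₀ g₁ x y z₀ z₁ R : ℝ}
    (hR : x ^ 2 + y ^ 2 = R) (hz : x ^ 2 - y ^ 2 = z₀ * x + z₁ * y) :
    ((g₀ + x) / a) ^ 2 + ((g₁ + y) / b) ^ 2 =
      g₀ ^ 2 / a ^ 2 + g₁ ^ 2 / b ^ 2 + (1 / a ^ 2 + 1 / b ^ 2) / 2 * R +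
        (2 * g₀ / a ^ 2 - z₀ * (1 / b ^ 2 - 1 / a ^ 2) / 2) * x +
        (2 * g₁ / b ^ 2 - z₁ * (1 / b ^ 2 - 1 / a ^ 2) / 2) * y := by
  have ha : 0 < a := hb.trans hab
  have hx : x ^ 2 = (R + (z₀ * x + z₁ * y)) / 2 := by linarith
  have hy : y ^ 2 = (R - (z₀ * x + z₁ * y)) / 2 := by linarith
  have : ((g₀ + x) / a) ^ 2 + ((g₁ + y) / b) ^ 2 = (g₀ ^ 2 + 2 * g₀ * x + x ^ 2) / a ^ 2 +
    (g₁ ^ 2 + 2 * g₁ * y + y ^ 2) / b ^ 2 := by ring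
  rw [this, hx, hy]
  ring

/-- For V = x + iy the hypotheses say V² = z · conj V. This survives V ↦ ωV for a primitive cube
root of unity ω, since ω² = conj ω; here t = Im ω. -/
theorem sq_sub_sq_rotate {x y z₀ z₁ t : ℝ} (h₀ : x ^ 2 - y ^ 2 = z₀ * x + z₁ * y)
    (h₁ : 2 * x * y = z₁ * x - z₀ * y) (ht : t ^ 2 = 3 / 4) :
    (-x / 2 - t * y) ^ 2 - (t * x - y / 2) ^ 2 =
      z₀ * (-x / 2 - t * y) + z₁ * (t * x - y / 2) := by
  linear_combination (-1 / 2) * h₀ + t * h₁ + (y ^ 2 - x ^ 2) * ht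

/-- Take z = V³/R. It is the same for all three vertices V, ωV, ω²V of an equilateral triangle about
its center. -/
theorem exists_cubic_direction (x₀ y₀ x₁ y₁ R : ℝ) (hR : R ≠ 0) (h0 : x₀ ^ 2 + y₀ ^ 2 = R)
    (h1 : x₁ ^ 2 + y₁ ^ 2 = R) (h2 : (x₀ + x₁) ^ 2 + (y₀ + y₁) ^ 2 = R) :
    ∃ z₀ z₁ : ℝ, z₀ ^ 2 + z₁ ^ 2 = R ∧ x₀ ^ 2 - y₀ ^ 2 = z₀ * x₀ + z₁ * y₀ ∧
      x₁ ^ 2 - y₁ ^ 2 = z₀ * x₁ + z₁ * y₁ ∧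
      (-(x₀ + x₁)) ^ 2 - (-(y₀ + y₁)) ^ 2 = z₀ * (-(x₀ + x₁)) + z₁ * (-(y₀ + y₁)) := by
  have hdot : x₀ * x₁ + y₀ * y₁ = -R / 2 := by linarith
  have hcross : (x₀ * y₁ - x₁ * y₀) ^ 2 = 3 * R ^ 2 / 4 := by
    linear_combination (x₁ ^ 2 + y₁ ^ 2) * h0 + R * h1 - (x₀ * x₁ + y₀ * y₁ - R / 2) * hdot
  obtain ⟨t, ht⟩ : ∃ t, t = (x₀ * y₁ - x₁ * y₀) / R := ⟨_, rfl⟩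
  have htR : t * R = x₀ * y₁ - x₁ * y₀ := by rw [ht]; field_simp
  have ht2 : t ^ 2 = 3 / 4 := by rw [ht, div_pow, hcross]; field_simp
  have hx₁ : x₁ = -x₀ / 2 - t * y₀ := by
    apply mul_left_cancel₀ hR
    linear_combination -x₁ * h0 + x₀ * hdot + y₀ * htR
  have hy₁ : y₁ = t * x₀ - y₀ / 2 := by
    apply mul_left_cancel₀ hR
    linear_combination -y₁ * h0 + y₀ * hdot - x₀ * htR
  have hx₂ : -(x₀ + x₁) = -x₀ / 2 - -t * y₀ := by rw [hx₁]; ring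
  have hy₂ : -(y₀ + y₁) = -t * x₀ - y₀ / 2 := by rw [hy₁]; ring
  have hq₀ : x₀ ^ 2 - y₀ ^ 2 = (x₀ ^ 3 - 3 * x₀ * y₀ ^ 2) / R * x₀ +
      (3 * x₀ ^ 2 * y₀ - y₀ ^ 3) / R * y₀ := by
    rw [← h0] at hR ⊢
    field_simp
    ring
  have hq₁ : 2 * x₀ * y₀ = (3 * x₀ ^ 2 * y₀ - y₀ ^ 3) / R * x₀ -
      (x₀ ^ 3 - 3 * x₀ * y₀ ^ 2) / R * y₀ := by
    rw [← h0] at hR ⊢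
    field_simp
    ring
  refine ⟨_, _, ?_, hq₀, ?_, ?_⟩
  · rw [← h0] at hR ⊢
    field_simp
    ring
  · rw [hx₁, hy₁]
    exact sq_sub_sq_rotate hq₀ hq₁ ht2
  · rw [hx₂, hy₂]
    exact sq_sub_sq_rotate hq₀ hq₁ (by rw [neg_sq, ht2])

theorem equilateralCentroidLocus_eq (hb : 0 < b) (hab : b < a) :
    equilateralCentroidLocus a b =
      axisEllipse (a * (a ^ 2 - b ^ 2) / (a ^ 2 + 3 * b ^ 2))
        (b * (a ^ 2 - b ^ 2) / (3 * a ^ 2 + b ^ 2)) := by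
  have ha : 0 < a := hb.trans hab
  have hc : 0 < a ^ 2 - b ^ 2 := by nlinarith
  ext p
  rw [mem_centroid_ellipse_iff hb hab]
  constructor
  · rintro ⟨t, ht, heq, rfl⟩
    rw [Affine.Triangle.equilateral_iff_dist_01_eq_02_and_dist_01_eq_12] at heq
    have d1 := congrArg (· ^ 2) heq.1
    have d2 := congrArg (· ^ 2) heq.2
    simp only [plane_dist_sq] at d1 d2
    have e : ∀ i, (t.points i 0 / a) ^ 2 + (t.points i 1 / b) ^ 2 = 1 := ht
    have hne : t.points 0 ≠ t.points 1 := t.independent.injective.ne (by decide)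
    have hpos : 0 < dist (t.points 0) (t.points 1) ^ 2 := by
      have := dist_pos.2 hne
      positivity
    rw [plane_dist_sq] at hpos
    have c0 := centroid_apply t 0
    have c1 := centroid_apply t 1
    generalize t.centroid = G at *
    have e0 := e 0
    have e1 := e 1
    have e2 := e 2
    generalize t.points 0 = P at *
    generalize t.points 1 = Q at *
    generalize t.points 2 = S at *
    obtain ⟨R, hR⟩ : ∃ R, R = ((P 0 - Q 0) ^ 2 + (P 1 - Q 1) ^ 2) / 3 := ⟨_, rfl⟩
    obtain ⟨x₀, hx₀⟩ : ∃ x₀, x₀ = P 0 - G 0 := ⟨_, rfl⟩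
    obtain ⟨y₀, hy₀⟩ : ∃ y₀, y₀ = P 1 - G 1 := ⟨_, rfl⟩
    obtain ⟨x₁, hx₁⟩ : ∃ x₁, x₁ = Q 0 - G 0 := ⟨_, rfl⟩
    obtain ⟨y₁, hy₁⟩ : ∃ y₁, y₁ = Q 1 - G 1 := ⟨_, rfl⟩
    have hS0 : S 0 = G 0 + -(x₀ + x₁) := by rw [hx₀, hx₁, c0]; ring
    have hS1 : S 1 = G 1 + -(y₀ + y₁) := by rw [hy₀, hy₁, c1]; ring
    have hP0 : P 0 = G 0 + x₀ := by rw [hx₀]; ring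
    have hP1 : P 1 = G 1 + y₀ := by rw [hy₀]; ring
    have hQ0 : Q 0 = G 0 + x₁ := by rw [hx₁]; ring
    have hQ1 : Q 1 = G 1 + y₁ := by rw [hy₁]; ring
    clear c0 c1
    rw [hP0, hP1, hQ0, hQ1] at d1 d2 hR hpos
    rw [hS0, hS1] at d1 d2
    have hR0 : R ≠ 0 := by rw [hR]; positivity
    have r0 : x₀ ^ 2 + y₀ ^ 2 = R := by rw [hR]; linarith
    have r1 : x₁ ^ 2 + y₁ ^ 2 = R := by rw [hR]; linarith
    have r2 : (x₀ + x₁) ^ 2 + (y₀ + y₁) ^ 2 = R := by rw [hR]; linarith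
    obtain ⟨z₀, z₁, hz, q0, q1, q2⟩ := exists_cubic_direction x₀ y₀ x₁ y₁ R hR0 r0 r1 r2
    rw [hP0, hP1, ellipse_expansion hb hab r0 q0] at e0
    rw [hQ0, hQ1, ellipse_expansion hb hab r1 q1] at e1
    rw [hS0, hS1, ellipse_expansion hb hab (R := R) (by linarith) q2] at e2
    obtain ⟨α, hα⟩ : ∃ α, α = 2 * G 0 / a ^ 2 - z₀ * (1 / b ^ 2 - 1 / a ^ 2) / 2 := ⟨_, rfl⟩
    obtain ⟨γ, hγ⟩ : ∃ γ, γ = 2 * G 1 / b ^ 2 - z₁ * (1 / b ^ 2 - 1 / a ^ 2) / 2 := ⟨_, rfl⟩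
    rw [← hα, ← hγ] at e0 e1 e2
    -- The offsets sum to zero, so adding the three equations isolates the constant part; the affine
    -- form then vanishes on two independent offsets and is zero. Thus z is determined by the
    -- centroid, and |z|² = R is the equation of the locus.
    have k0 : α * x₀ + γ * y₀ = 0 := by linarith
    have k1 : α * x₁ + γ * y₁ = 0 := by linarith
    have hdot : x₀ * x₁ + y₀ * y₁ = -R / 2 := by linarith
    have hcross : (x₀ * y₁ - x₁ * y₀) ^ 2 = 3 * R ^ 2 / 4 := by
      linear_combination (x₁ ^ 2 + y₁ ^ 2) * r0 + R * r1 - (x₀ * x₁ + y₀ * y₁ - R / 2) * hdot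
    have hcross0 : x₀ * y₁ - x₁ * y₀ ≠ 0 := by
      intro h0
      rw [h0] at hcross
      have : 0 < 3 * R ^ 2 / 4 := by positivity
      linarith
    have hα0 : α = 0 := by
      apply mul_right_cancel₀ hcross0
      linear_combination y₁ * k0 - y₀ * k1
    have hγ0 : γ = 0 := by
      apply mul_right_cancel₀ hcross0
      linear_combination x₀ * k1 - x₁ * k0
    have hz0 : 4 * b ^ 2 * G 0 / (a ^ 2 - b ^ 2) = z₀ := by
      rw [hα0] at hα
      field_simp at hα
      field_simp
      linarith
    have hz1 : 4 * a ^ 2 * G 1 / (a ^ 2 - b ^ 2) = z₁ := by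
      rw [hγ0] at hγ
      field_simp at hγ
      field_simp
      linarith
    rw [hz0, hz1, hz]
    linarith
  · intro hp
    obtain ⟨z₀, hz0⟩ : ∃ z₀, z₀ = 4 * b ^ 2 * p 0 / (a ^ 2 - b ^ 2) := ⟨_, rfl⟩
    obtain ⟨z₁, hz1⟩ : ∃ z₁, z₁ = 4 * a ^ 2 * p 1 / (a ^ 2 - b ^ 2) := ⟨_, rfl⟩
    rw [← hz0, ← hz1] at hp
    have k0 : 2 * p 0 / a ^ 2 - z₀ * (1 / b ^ 2 - 1 / a ^ 2) / 2 = 0 := by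
      rw [hz0]
      field_simp
      ring
    have k1 : 2 * p 1 / b ^ 2 - z₁ * (1 / b ^ 2 - 1 / a ^ 2) / 2 = 0 := by
      rw [hz1]
      field_simp
      ring
    have hR0 : 0 < z₀ ^ 2 + z₁ ^ 2 := by
      by_contra hcon
      have n0 : z₀ = 0 := by nlinarith [sq_nonneg z₀, sq_nonneg z₁]
      have n1 : z₁ = 0 := by nlinarith [sq_nonneg z₀, sq_nonneg z₁]
      rw [n0] at hz0 k0
      rw [n1] at hz1 k1
      have m0 : p 0 = 0 := by
        simpa [ha.ne'] using k0
      have m1 : p 1 = 0 := by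
        simpa [hb.ne'] using k1
      rw [n0, n1, m0, m1] at hp
      norm_num at hp
    -- The vertices are recovered from V³ = Rz with R = |z|².
    obtain ⟨V, hV⟩ := IsAlgClosed.exists_pow_nat_eq
      ((⟨z₀, z₁⟩ : ℂ) * ((z₀ ^ 2 + z₁ ^ 2 : ℝ) : ℂ)) (show 0 < 3 by norm_num)
    have hnV : V.re ^ 2 + V.im ^ 2 = z₀ ^ 2 + z₁ ^ 2 := by
      have h1 := congrArg (fun w => ‖w‖ ^ 2) hV
      simp only [norm_pow, norm_mul, mul_pow] at h1
      rw [complex_norm_sq ⟨z₀, z₁⟩, complex_norm_sq ((z₀ ^ 2 + z₁ ^ 2 : ℝ) : ℂ)] at h1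
      rw [Complex.ofReal_re, Complex.ofReal_im] at h1
      rw [← complex_norm_sq]
      refine (pow_left_inj₀ (by positivity) hR0.le three_ne_zero).1 ?_
      linear_combination h1
    have hVq : V ^ 2 = (⟨z₀, z₁⟩ : ℂ) * conj V := by
      have hV0 : V ≠ 0 := by
        intro h0
        rw [h0] at hnV
        simp at hnV
        linarith
      apply mul_right_cancel₀ hV0
      rw [mul_assoc, mul_comm (conj V), Complex.mul_conj, Complex.normSq_apply, ← sq, ← sq, hnV,
        ← hV]
      ring
    have q0 := congrArg Complex.re hVq
    have q1 := congrArg Complex.im hVq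
    simp [sq] at q0 q1
    generalize V.re = x at *
    generalize V.im = y at *
    have h3 : √3 ^ 2 = 3 := Real.sq_sqrt (by norm_num)
    have h30 : 0 < √3 := by positivity
    obtain ⟨s, hs⟩ : ∃ s, s = √3 := ⟨_, rfl⟩
    rw [← hs] at h3 h30
    have hon : ∀ x y : ℝ, x ^ 2 + y ^ 2 = z₀ ^ 2 + z₁ ^ 2 → x ^ 2 - y ^ 2 = z₀ * x + z₁ * y →
        ((p 0 + x) / a) ^ 2 + ((p 1 + y) / b) ^ 2 = 1 := by
      intro x y hxy hq
      rw [ellipse_expansion hb hab hxy hq, k0, k1]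
      linarith
    have hdist : ∀ p q s t : Plane, (p 0 - q 0) ^ 2 + (p 1 - q 1) ^ 2 =
        (s 0 - t 0) ^ 2 + (s 1 - t 1) ^ 2 → dist p q = dist s t := by
      intro p q s t h
      rw [← plane_dist_sq, ← plane_dist_sq] at h
      exact (pow_left_inj₀ dist_nonneg dist_nonneg two_ne_zero).1 h
    refine ⟨⟨![!₂[p 0 + x, p 1 + y],
      !₂[p 0 + (-x / 2 - s / 2 * y), p 1 + (s / 2 * x - y / 2)],
      !₂[p 0 + (-x / 2 + s / 2 * y), p 1 + (-s / 2 * x - y / 2)]],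
      affineIndependent_of_cross_ne_zero ?_⟩, ?_, ?_, ?_⟩
    · simp only [cross, Matrix.cons_val_zero, Matrix.cons_val_one, Matrix.cons_val]
      have : 0 < 3 * s / 2 * (z₀ ^ 2 + z₁ ^ 2) := by positivity
      rw [← hnV] at this
      simp
      ring_nf at this ⊢
      exact this.ne'
    · intro i
      fin_cases i
      · exact hon _ _ hnV (by linear_combination q0)
      · exact hon _ _ (by linear_combination hnV + (x ^ 2 + y ^ 2) / 4 * h3) (by
          have := sq_sub_sq_rotate (x := x) (y := y) (z₀ := z₀) (z₁ := z₁)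
            (t := s / 2) (h₀ := by linear_combination q0)
            (h₁ := by linear_combination q1) (by linear_combination h3 / 4)
          linear_combination this)
      · exact hon _ _ (by linear_combination hnV + (x ^ 2 + y ^ 2) / 4 * h3) (by
          have := sq_sub_sq_rotate (x := x) (y := y) (z₀ := z₀) (z₁ := z₁)
            (t := -s / 2) (h₀ := by linear_combination q0)
            (h₁ := by linear_combination q1) (by linear_combination h3 / 4)
          linear_combination this)
    · rw [Affine.Triangle.equilateral_iff_dist_01_eq_02_and_dist_01_eq_12]
      constructor
      · apply hdist
        simp
        ring
      · apply hdist
        simp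
        linear_combination (-3 / 4) * (x ^ 2 + y ^ 2) * h3
    · apply plane_ext
      · rw [centroid_apply]
        simp
        ring
      · rw [centroid_apply]
        simp
        ring

end Equilateral

/-! ### Eccentricity against the position of C. -/

section Classification

variable {a b r : ℝ} {C : Plane}

/-- The eccentricity criterion when the center of the incircle is close to the origin. -/
theorem lt_of_center_interior {s M G k D e w : ℝ} (hs : 0 < s) (hM : 0 < M) (hG : 0 < G)
    (hk : 0 < k) (hkM : k = M ^ 2 - 4 * G) (hDe : e = D - M * s)
    (hsq : e ^ 2 = 4 * s * (G * s + w)) (hw : 8 * M * w < k * D) : 4 * w < k * s := by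
  by_contra! hcon
  have h1 : 2 * M * (k * s) ≤ 2 * M * (4 * w) := mul_le_mul_of_nonneg_left hcon (by positivity)
  have h2 : 2 * M * s < D := lt_of_mul_lt_mul_left (by linarith) hk.le
  -- The parabolic case 4w = ks forces e = Ms and D = 2Ms, so δ measures the deviation from it; `h4`
  -- is the relation `hsq` rewritten in δ.
  obtain ⟨δ, hδ⟩ : ∃ δ, δ = D - 2 * M * s := ⟨_, rfl⟩
  have hδ0 : 0 < δ := by linarith
  have h3 : s * (8 * M * w) < s * (k * D) := mul_lt_mul_of_pos_left hw hs
  have h4 : 2 * M * δ ^ 2 + (3 * M ^ 2 + 4 * G) * s * δ = s * (8 * M * w) - s * (k * D) := by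
    have hD : D = δ + 2 * M * s := by linarith
    rw [hDe, hD] at hsq
    rw [hD, hkM]
    linear_combination 2 * M * hsq
  have h5 : 0 < 2 * M * δ ^ 2 + (3 * M ^ 2 + 4 * G) * s * δ := by positivity
  linarith

/-- The eccentricity criterion when the center of the incircle is far from the origin. -/
theorem lt_of_center_exterior {s M G k D e w : ℝ} (hs : 0 < s) (hM : 0 < M) (hG : 0 < G)
    (hk : 0 < k) (hkM : k = M ^ 2 - 4 * G) (he : 0 < e) (hDe : e = D - M * s)
    (hsq : e ^ 2 = 4 * s * (G * s + w)) (hw : k * D < 8 * M * w) : k * s < 4 * w := by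
  by_contra! hcon
  have h1 : 2 * M * (4 * w) ≤ 2 * M * (k * s) := mul_le_mul_of_nonneg_left hcon (by positivity)
  have h2 : D < 2 * M * s := lt_of_mul_lt_mul_left (by linarith) hk.le
  obtain ⟨δ, hδ⟩ : ∃ δ, δ = 2 * M * s - D := ⟨_, rfl⟩
  have hδ0 : 0 < δ := by linarith
  have h3 : s * (k * D) < s * (8 * M * w) := mul_lt_mul_of_pos_left hw hs
  have h4 : δ * (2 * M * δ - (3 * M ^ 2 + 4 * G) * s) = s * (8 * M * w) - s * (k * D) := by
    have hD : D = 2 * M * s - δ := by linarith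
    rw [hDe, hD] at hsq
    rw [hD, hkM]
    linear_combination 2 * M * hsq
  -- The quadratic in δ alone allows this range; e > 0 gives Mδ < M²s and rules it out.
  have h5 : 0 < 2 * M * δ - (3 * M ^ 2 + 4 * G) * s :=
    pos_of_mul_pos_right (by linarith) hδ0.le
  have h6 : 0 < 2 * M * e := by positivity
  have h7 : 0 < M ^ 2 * s := by positivity
  have h8 : 0 < G * s := by positivity
  have h9 : M * δ = M ^ 2 * s - M * e := by rw [hδ, hDe]; ring
  linarith

theorem polarValue_pos (hb : 0 < b) (hab : b < a) (hp : IsPoristic a b r (chart a b C)) :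
    0 < polarValue a b r C := by
  have ha : 0 < a := hb.trans hab
  have hr := hp.r_pos
  have hd := defect_pos hb hab hp
  rw [polarValue]
  positivity

/-- Puts the equation of the centroid ellipse in the shape kD against 8Mw needed by the eccentricity
criteria. -/
theorem center_ratio_sq (hb : 0 < b) (hab : b < a) (C : Plane) :
    (a ^ 2 - b ^ 2) ^ 2 * ((C 0 / (a * (a ^ 2 - b ^ 2) / (a ^ 2 + 3 * b ^ 2))) ^ 2 +
      (C 1 / (b * (a ^ 2 - b ^ 2) / (3 * a ^ 2 + b ^ 2))) ^ 2) =
    (a ^ 2 - b ^ 2) ^ 2 * ((C 0 / a) ^ 2 + (C 1 / b) ^ 2) +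
      8 * (a ^ 2 + b ^ 2) * (b ^ 2 * (C 0 / a) ^ 2 + a ^ 2 * (C 1 / b) ^ 2) := by
  have ha : 0 < a := hb.trans hab
  have hc : a ^ 2 - b ^ 2 ≠ 0 := by nlinarith
  field_simp
  ring

theorem axisVector_norm_lt_of_interior (hb : 0 < b) (hab : b < a)
    (hp : IsPoristic a b r (chart a b C))
    (hC : C ∈ axisEllipseInterior (a * (a ^ 2 - b ^ 2) / (a ^ 2 + 3 * b ^ 2))
      (b * (a ^ 2 - b ^ 2) / (3 * a ^ 2 + b ^ 2))) :
    4 * a ^ 2 * b ^ 2 * ‖axisVector a b (chart a b C)‖ ^ 2 <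
      (a ^ 2 - b ^ 2) ^ 2 * r ^ 2 / (a ^ 2 * b ^ 2) := by
  have ha : 0 < a := hb.trans hab
  have hr := hp.r_pos
  have hc : 0 < a ^ 2 - b ^ 2 := by nlinarith
  have hd := defect_eq hp
  have hd2 := defect_sq ha.ne' hb.ne' hp
  have hC' := mul_lt_mul_of_pos_left (Set.mem_ofPred_eq ▸ hC) (sq_pos_of_pos hc)
  rw [center_ratio_sq hb hab] at hC'
  rw [axisVector_norm_sq]
  -- `hDe` and `hsq` are the two evaluations of the defect. In this dictionary 4a²b²‖v‖² = 4w and K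
  -- = ks.
  have h := lt_of_center_interior (s := r ^ 2 / (a ^ 2 * b ^ 2)) (M := a ^ 2 + b ^ 2)
    (G := a ^ 2 * b ^ 2) (k := (a ^ 2 - b ^ 2) ^ 2)
    (D := 1 - (chart a b C).re ^ 2 - (chart a b C).im ^ 2)
    (e := defect a b r (chart a b C) / 2)
    (w := b ^ 2 * (chart a b C).re ^ 2 + a ^ 2 * (chart a b C).im ^ 2)
    (by positivity) (by positivity) (by positivity) (by positivity) (by ring)
    (by rw [hd]; field_simp; ring) (by rw [div_pow, hd2]; field_simp; ring)
    (by simp only [chart]; linarith)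
  convert h using 1
  · field_simp
  · ring

theorem lt_axisVector_norm_of_exterior (hb : 0 < b) (hab : b < a)
    (hp : IsPoristic a b r (chart a b C))
    (hC : C ∈ axisEllipseExterior (a * (a ^ 2 - b ^ 2) / (a ^ 2 + 3 * b ^ 2))
      (b * (a ^ 2 - b ^ 2) / (3 * a ^ 2 + b ^ 2))) :
    (a ^ 2 - b ^ 2) ^ 2 * r ^ 2 / (a ^ 2 * b ^ 2) <
      4 * a ^ 2 * b ^ 2 * ‖axisVector a b (chart a b C)‖ ^ 2 := by
  have ha : 0 < a := hb.trans hab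
  have hr := hp.r_pos
  have hc : 0 < a ^ 2 - b ^ 2 := by nlinarith
  have hd := defect_eq hp
  have hd0 := defect_pos hb hab hp
  have hd2 := defect_sq ha.ne' hb.ne' hp
  have hC' := mul_lt_mul_of_pos_left (Set.mem_ofPred_eq ▸ hC) (sq_pos_of_pos hc)
  rw [center_ratio_sq hb hab] at hC'
  rw [axisVector_norm_sq]
  have h := lt_of_center_exterior (s := r ^ 2 / (a ^ 2 * b ^ 2)) (M := a ^ 2 + b ^ 2)
    (G := a ^ 2 * b ^ 2) (k := (a ^ 2 - b ^ 2) ^ 2)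
    (D := 1 - (chart a b C).re ^ 2 - (chart a b C).im ^ 2)
    (e := defect a b r (chart a b C) / 2)
    (w := b ^ 2 * (chart a b C).re ^ 2 + a ^ 2 * (chart a b C).im ^ 2)
    (by positivity) (by positivity) (by positivity) (by positivity) (by ring) (by positivity)
    (by rw [hd]; field_simp; ring) (by rw [div_pow, hd2]; field_simp; ring)
    (by simp only [chart]; linarith)
  convert h using 1
  · ring
  · field_simp

theorem line_foci_eq_mk'_polarCenter (hb : 0 < b) (hab : b < a) :
    line[ℝ, focusX a b C, focusY a b C] = AffineSubspace.mk' (polarCenter a b r C)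
      (Submodule.span ℝ {axisVector a b (chart a b C)}) := by
  rw [line_focusX_focusY hb hab, polarCenter, mk'_add_smul_span_singleton]

variable {T : ℝ → Affine.Triangle ℝ Plane}

theorem envelope_isEllipseAlong (hb : 0 < b) (hab : b < a)
    (hp : IsPoristic a b r (chart a b C)) (hT : IsRegularParametrization a b C r T)
    (hJ : 4 * a ^ 2 * b ^ 2 * ‖axisVector a b (chart a b C)‖ ^ 2 <
      (a ^ 2 - b ^ 2) ^ 2 * r ^ 2 / (a ^ 2 * b ^ 2)) :
    IsEllipseAlong (envelope fun u => radicalFunction (T u))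
      line[ℝ, focusX a b C, focusY a b C] := by
  have ha : 0 < a := hb.trans hab
  have hr := hp.r_pos
  have hc : 0 < a ^ 2 - b ^ 2 := by nlinarith
  rw [line_foci_eq_mk'_polarCenter (r := r) hb hab]
  refine isEllipseAlong_of_focal_form (by positivity) (polarValue_pos hb hab hp) (by positivity)
    ?_ hJ (mem_envelope_iff hb hab hp hT)
  linarith [sq_pos_of_pos hc]

theorem envelope_isHyperbolaAlong (hb : 0 < b) (hab : b < a)
    (hp : IsPoristic a b r (chart a b C)) (hT : IsRegularParametrization a b C r T)
    (hJ : (a ^ 2 - b ^ 2) ^ 2 * r ^ 2 / (a ^ 2 * b ^ 2) <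
      4 * a ^ 2 * b ^ 2 * ‖axisVector a b (chart a b C)‖ ^ 2) :
    IsHyperbolaAlong (envelope fun u => radicalFunction (T u))
      line[ℝ, focusX a b C, focusY a b C] := by
  have ha : 0 < a := hb.trans hab
  have hr := hp.r_pos
  have hc : 0 < a ^ 2 - b ^ 2 := by nlinarith
  rw [line_foci_eq_mk'_polarCenter (r := r) hb hab]
  refine isHyperbolaAlong_of_focal_form (by positivity) (polarValue_pos hb hab hp) (by positivity)
    ?_ hJ (mem_envelope_iff hb hab hp hT)
  linarith [sq_pos_of_pos hc]

theorem envelope_isConicAlong (hb : 0 < b) (hab : b < a)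
    (hp : IsPoristic a b r (chart a b C)) (hT : IsRegularParametrization a b C r T) :
    IsConicAlong (envelope fun u => radicalFunction (T u))
      line[ℝ, focusX a b C, focusY a b C] := by
  rcases lt_trichotomy (4 * a ^ 2 * b ^ 2 * ‖axisVector a b (chart a b C)‖ ^ 2)
    ((a ^ 2 - b ^ 2) ^ 2 * r ^ 2 / (a ^ 2 * b ^ 2)) with hJ | hJ | hJ
  · exact Or.inl (envelope_isEllipseAlong hb hab hp hT hJ)
  · have ha : 0 < a := hb.trans hab
    have hr := hp.r_pos
    have hc : 0 < a ^ 2 - b ^ 2 := by nlinarith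
    rw [line_foci_eq_mk'_polarCenter (r := r) hb hab]
    exact Or.inr (Or.inl (isParabolaAlong_of_focal_form (by positivity)
      (polarValue_pos hb hab hp) (by positivity) hJ.symm (mem_envelope_iff hb hab hp hT)))
  · exact Or.inr (Or.inr (envelope_isHyperbolaAlong hb hab hp hT hJ))

end Classification

end PonceletEnvelope

theorem mainTheorem5 (a b : ℝ) (hb : 0 < b) (hab : b < a) (C : PonceletEnvelope.Plane) (r : ℝ)
    (hT : (PonceletEnvelope.ponceletFamily a b C r).Nonempty) :
    -- the circumcenter locus is an ellipse with foci `F₃`, `F₃'`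
    PonceletEnvelope.IsEllipseWithFoci (PonceletEnvelope.circumcenterLocus a b C r)
      (PonceletEnvelope.focusX a b C) (PonceletEnvelope.focusY a b C) ∧
    -- the foci are distinct unless `C` is the center of the outer ellipse
    (C ≠ 0 → PonceletEnvelope.focusX a b C ≠ PonceletEnvelope.focusY a b C) ∧
    -- the locus of centroids of inscribed equilaterals is an ellipse
    PonceletEnvelope.equilateralCentroidLocus a b =
      PonceletEnvelope.axisEllipse (a * (a ^ 2 - b ^ 2) / (a ^ 2 + 3 * b ^ 2))
        (b * (a ^ 2 - b ^ 2) / (3 * a ^ 2 + b ^ 2)) ∧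
    -- the Poncelet family is a regular one-parameter family
    (∃ T, PonceletEnvelope.IsRegularParametrization a b C r T) ∧
    -- the envelope of the radical axis
    ∀ T, PonceletEnvelope.IsRegularParametrization a b C r T →
      PonceletEnvelope.IsConicAlong
        (PonceletEnvelope.envelope fun u => PonceletEnvelope.radicalFunction (T u))
        line[ℝ, PonceletEnvelope.focusX a b C, PonceletEnvelope.focusY a b C] ∧
      (C ∈ PonceletEnvelope.axisEllipseInterior (a * (a ^ 2 - b ^ 2) / (a ^ 2 + 3 * b ^ 2))
          (b * (a ^ 2 - b ^ 2) / (3 * a ^ 2 + b ^ 2)) →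
        PonceletEnvelope.IsEllipseAlong
          (PonceletEnvelope.envelope fun u => PonceletEnvelope.radicalFunction (T u))
          line[ℝ, PonceletEnvelope.focusX a b C, PonceletEnvelope.focusY a b C]) ∧
      (C ∈ PonceletEnvelope.axisEllipseExterior (a * (a ^ 2 - b ^ 2) / (a ^ 2 + 3 * b ^ 2))
          (b * (a ^ 2 - b ^ 2) / (3 * a ^ 2 + b ^ 2)) →
        PonceletEnvelope.IsHyperbolaAlong
          (PonceletEnvelope.envelope fun u => PonceletEnvelope.radicalFunction (T u))
          line[ℝ, PonceletEnvelope.focusX a b C, PonceletEnvelope.focusY a b C]) := by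
  have hp := PonceletEnvelope.isPoristic_of_nonempty hb hab hT
  refine ⟨PonceletEnvelope.circumcenterLocus_isEllipse hb hab hp,
    PonceletEnvelope.focusX_ne_focusY hb hab,
    PonceletEnvelope.equilateralCentroidLocus_eq hb hab,
    PonceletEnvelope.exists_regularParametrization hb hab hp, fun T hT' =>
    ⟨PonceletEnvelope.envelope_isConicAlong hb hab hp hT', fun hC => ?_, fun hC => ?_⟩⟩
  · exact PonceletEnvelope.envelope_isEllipseAlong hb hab hp hT'
      (PonceletEnvelope.axisVector_norm_lt_of_interior hb hab hp hC)
  · exact PonceletEnvelope.envelope_isHyperbolaAlong hb hab hp hT'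
      (PonceletEnvelope.lt_axisVector_norm_of_exterior hb hab hp hC)
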